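/- Let $\mathcal E$ be a cofibrant $E_\infty$ operad over $\mathbb Z$: an operad in $\mathbb Z$-graded complexes of abelian groups such that $\mathcal E$ is quasi-isomorphic, by an augmentation, to the operad of commutative algebras, each complex $\mathcal E(n)$ consists of projective $\mathbb Z[\Sigma_n]$-modules, and every morphism of operads from $\mathcal E$ to the target of an arity-wise surjective quasi-isomorphism of operads lifts to its source. Let $\mathfrak E$ be the category of $\mathcal E$-algebras ("$E_\infty$ algebras"). An $E_\infty$ algebra $A$ is called cofibrant if every morphism $A\to C$ lifts along every surjective quasi-isomorphism $B\to C$ of $E_\infty$ algebras. For a simplicial set $X$ and a commutative ring $R$ let $C^*(X;R)$ be the complex of normalized cochains of $X$ with coefficients in $R$, made into an $E_\infty$ algebra by an $\mathcal E$-algebra structure which is natural in $X$ and in $R$ (any such natural structure is allowed). For an $E_\infty$ algebra $A$ let $T(A;R)$ be the simplicial set $$T(A;R)_n=\mathfrak E\bigl(A,\,C^*(\Delta[n];R)\bigr)$$ of $E_\infty$ algebra maps, and write $U(A)=T(A;\mathbb Z)$. Let $\mathbb Z^\wedge=\prod_p\mathbb Z_p$ be the product of the $p$-adic integers over all primes $p$,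 and let $\mathbb Q^\wedge=\mathbb Z^\wedge\otimes_{\mathbb Z}\mathbb Q$. **Theorem.** Let $A$ be a cofibrant $E_\infty$ algebra. Then the commutative square of simplicial sets $$\begin{array}{ccc}U(A)&\longrightarrow&T(A;\mathbb Z^\wedge)\\ \downarrow&&\downarrow\\ T(A;\mathbb Q)&\longrightarrow&T(A;\mathbb Q^\wedge)\end{array}$$ induced by the inclusions $\mathbb Z\to\mathbb Z^\wedge$, $\mathbb Z\to\mathbb Q$, $\mathbb Z^\wedge\to\mathbb Q^\wedge$, $\mathbb Q\to\mathbb Q^\wedge$ is homotopy cartesian, i.e., the induced map from $U(A)$ to the homotopy pullback of $T(A;\mathbb Z^\wedge)\to T(A;\mathbb Q^\wedge)$ along $T(A;\mathbb Q)\to T(A;\mathbb Q^\wedge)$ is a weak equivalence. Explicitly: for a replacement of the cospan $T(A;\mathbb Z^\wedge)\to T(A;\mathbb Q^\wedge)\leftarrow T(A;\mathbb Q)$ by a weakly equivalent cospan $X'\to Z'\leftarrow Y'$ of Kan fibrations over a Kan complex $Z'$, the induced map $U(A)\to X'\times_{Z'}Y'$ is a weak equivalence (this does not depend on the choice of the replacement).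 -/

import Mathlib

open CategoryTheory Limits Opposite Simplicial HomotopicalAlgebra
open SSet.modelCategoryQuillen

noncomputable section

/-! ### Differential graded operads over the integers and their algebras -/

/-- Complexes of abelian groups, graded by `ℤ`, with differentials of degree `+1`. -/
abbrev Cplx : Type 1 := CochainComplex (ModuleCat.{0} ℤ) ℤ

/-- The Koszul sign of the rearrangement of `a 0 ⊗ ⋯ ⊗ a (m - 1)` into
`a (σ 0) ⊗ ⋯ ⊗ a (σ (n - 1))` (so `n = m`), where `a i` has degree `q i`. -/
def permSign {n m : ℕ} (σ : Fin n ≃ Fin m) (q : Fin m → ℤ) : ℤˣ :=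
  ∏ j : Fin n, ∏ i : Fin n, if i < j ∧ σ j < σ i then (q (σ i) * q (σ j)).negOnePow else 1

/-- The Koszul sign of the rearrangement of `y 0 ⊗ ⋯ ⊗ y (n - 1) ⊗ z 0 ⊗ ⋯ ⊗ z (n - 1)` into
`y 0 ⊗ z 0 ⊗ ⋯ ⊗ y (n - 1) ⊗ z (n - 1)`, where `y i` has degree `s i` and `z i` has degree `t i`. -/
def shuffleSign {n : ℕ} (s t : Fin n → ℤ) : ℤˣ :=
  ∏ j : Fin n, ∏ i : Fin n, if i < j then (s j * t i).negOnePow else 1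

/-- The degrees `q`, with the `j`-th one raised by `1`. -/
def raise {n : ℕ} (q : Fin n → ℤ) (j : Fin n) : Fin n → ℤ := fun i => if i = j then q i + 1 else q i

/-- The family obtained from `a` by applying the differential to its `j`-th member
and leaving the other members unchanged. -/
def dAt {n : ℕ} (F : Fin n → Cplx) (q : Fin n → ℤ) (j : Fin n) (a : ∀ i, (F i).X (q i)) (i : Fin n) :
    (F i).X (raise q j i) :=
  if h : i = j then ((F i).d (q i) (raise q j i)).hom (a i)
  else ((F i).XIsoOfEq (if_neg h).symm).hom.hom (a i)

lemma degree_dAt {n : ℕ} {p r : ℤ} {q : Fin n → ℤ} (h : p + ∑ i, q i = r) (j : Fin n) :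
    p + ∑ i, raise q j i = r + 1 := by
  have : ∀ i, raise q j i = q i + if i = j then 1 else 0 := fun i => by
    unfold raise; split_ifs <;> simp
  simp [this, Finset.sum_add_distrib, ← h, add_assoc]

lemma degree_d {n : ℕ} {p r : ℤ} {q : Fin n → ℤ} (h : p + ∑ i, q i = r) :
    p + 1 + ∑ i, q i = r + 1 := by
  omega

lemma degree_perm {n m : ℕ} {p r : ℤ} {q : Fin m → ℤ} (h : p + ∑ i, q i = r) (σ : Fin n ≃ Fin m) :
    p + ∑ i, q (σ i) = r := by
  rw [← h, σ.sum_comp q]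

lemma sum_block {n : ℕ} (k : Fin n → ℕ) (c : Fin (∑ j, k j) → ℕ) :
    ∑ j, ∑ i, c (finSigmaFinEquiv ⟨j, i⟩) = ∑ l, c l := by
  rw [← finSigmaFinEquiv.sum_comp c, Fintype.sum_sigma]

/-- A (symmetric, unital) operad in complexes of abelian groups.

`map σ` relabels the inputs of an operation along `σ`; for `n = m` this is the (left) action of the
symmetric group.  `comp k p s r h x y` is the total composition `γ(x; y 0, …, y (n - 1))` of `x` of
arity `n` and degree `p` with `y j` of arity `k j` and degree `s j`; the inputs of the composite are
numbered in lexicographic order. -/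
structure DGOperad where
  obj : ℕ → Cplx
  map {n m : ℕ} (σ : Fin n ≃ Fin m) : obj n ⟶ obj m
  one : (obj 1).X 0
  comp {n : ℕ} (k : Fin n → ℕ) (p : ℤ) (s : Fin n → ℤ) (r : ℤ) (h : p + ∑ j, s j = r) :
    (obj n).X p →ₗ[ℤ] MultilinearMap ℤ (fun j => (obj (k j)).X (s j)) ((obj (∑ j, k j)).X r)
  map_refl (n : ℕ) : map (Equiv.refl (Fin n)) = 𝟙 (obj n)
  map_trans {n m l : ℕ} (σ : Fin n ≃ Fin m) (τ : Fin m ≃ Fin l) :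
    map (σ.trans τ) = map σ ≫ map τ
  d_one : ((obj 1).d 0 1).hom one = 0
  /-- Composition is a chain map. -/
  d_comp {n : ℕ} (k : Fin n → ℕ) (p : ℤ) (s : Fin n → ℤ) (r : ℤ) (h : p + ∑ j, s j = r)
    (x : (obj n).X p) (y : ∀ j, (obj (k j)).X (s j)) :
    ((obj (∑ j, k j)).d r (r + 1)).hom (comp k p s r h x y) =
      comp k (p + 1) s (r + 1) (degree_d h) (((obj n).d p (p + 1)).hom x) y +
      ∑ j, (p + ∑ i ∈ Finset.Iio j, s i).negOnePow •
        comp k p (raise s j) (r + 1) (degree_dAt h j) x (dAt (fun i => obj (k i)) s j y)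
  one_comp (k : ℕ) (s : ℤ) (y : (obj k).X s) :
    comp (fun _ : Fin 1 => k) 0 (fun _ => s) s (by simp) one (fun _ => y) =
      ((map (finCongr (by simp))).f s).hom y
  comp_one (n : ℕ) (p : ℤ) (x : (obj n).X p) :
    comp (fun _ : Fin n => 1) p (fun _ => 0) p (by simp) x (fun _ => one) =
      ((map (finCongr (by simp))).f p).hom x
  /-- Associativity. -/
  comp_comp {n : ℕ} (k : Fin n → ℕ) (c : Fin (∑ j, k j) → ℕ)
    (p : ℤ) (s : Fin n → ℤ) (q : Fin (∑ j, k j) → ℤ) (u : ℤ) (v : Fin n → ℤ) (r : ℤ)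
    (hu : p + ∑ j, s j = u) (hr : u + ∑ l, q l = r)
    (hv : ∀ j, s j + ∑ i, q (finSigmaFinEquiv ⟨j, i⟩) = v j) (hr' : p + ∑ j, v j = r)
    (x : (obj n).X p) (y : ∀ j, (obj (k j)).X (s j)) (z : ∀ l, (obj (c l)).X (q l)) :
    comp c u q r hr (comp k p s u hu x y) z =
      shuffleSign s (fun j => ∑ i, q (finSigmaFinEquiv ⟨j, i⟩)) •
        ((map (finCongr (sum_block k c))).f r).hom
          (comp (fun j => ∑ i, c (finSigmaFinEquiv ⟨j, i⟩)) p v r hr' x fun j =>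
            comp (fun i => c (finSigmaFinEquiv ⟨j, i⟩)) (s j)
              (fun i => q (finSigmaFinEquiv ⟨j, i⟩)) (v j) (hv j) (y j)
              fun i => z (finSigmaFinEquiv ⟨j, i⟩))
  /-- Equivariance in the outer variable. -/
  map_comp {n m : ℕ} (σ : Fin n ≃ Fin m) (k : Fin m → ℕ) (p : ℤ) (s : Fin m → ℤ) (r : ℤ)
    (h : p + ∑ j, s j = r) (x : (obj n).X p) (y : ∀ j, (obj (k j)).X (s j)) :
    comp k p s r h (((map σ).f p).hom x) y =
      permSign σ s •
        ((map (finSigmaFinEquiv.symm.trans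
            ((Equiv.sigmaCongrLeft (β := fun j => Fin (k j)) σ).trans finSigmaFinEquiv))).f r).hom
          (comp (fun j => k (σ j)) p (fun j => s (σ j)) r (degree_perm h σ) x (fun j => y (σ j)))
  /-- Equivariance in the inner variables. -/
  comp_map {n : ℕ} (k l : Fin n → ℕ) (σ : ∀ j, Fin (k j) ≃ Fin (l j)) (p : ℤ) (s : Fin n → ℤ)
    (r : ℤ) (h : p + ∑ j, s j = r) (x : (obj n).X p) (y : ∀ j, (obj (k j)).X (s j)) :
    comp l p s r h x (fun j => ((map (σ j)).f (s j)).hom (y j)) =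
      ((map (finSigmaFinEquiv.symm.trans
          ((Equiv.sigmaCongrRight σ).trans finSigmaFinEquiv))).f r).hom
        (comp k p s r h x y)

namespace DGOperad

/-- Morphisms of operads. -/
@[ext]
structure Hom (P Q : DGOperad) where
  app (n : ℕ) : P.obj n ⟶ Q.obj n
  map_app {n m : ℕ} (σ : Fin n ≃ Fin m) : P.map σ ≫ app m = app n ≫ Q.map σ
  app_one : ((app 1).f 0).hom P.one = Q.one
  app_comp {n : ℕ} (k : Fin n → ℕ) (p : ℤ) (s : Fin n → ℤ) (r : ℤ) (h : p + ∑ j, s j = r)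
    (x : (P.obj n).X p) (y : ∀ j, (P.obj (k j)).X (s j)) :
    ((app (∑ j, k j)).f r).hom (P.comp k p s r h x y) =
      Q.comp k p s r h (((app n).f p).hom x) (fun j => ((app (k j)).f (s j)).hom (y j))

instance : Category DGOperad where
  Hom := Hom
  id P :=
    { app := fun n => 𝟙 (P.obj n)
      map_app := by simp
      app_one := by simp
      app_comp := by simp }
  comp {P Q S} f g :=
    { app := fun n => f.app n ≫ g.app n
      map_app := fun σ => by rw [← Category.assoc, f.map_app, Category.assoc, g.map_app,
        Category.assoc]
      app_one := by simp [f.app_one, g.app_one]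
      app_comp := by simp [f.app_comp, g.app_comp] }

/-- An operad is cofibrant if its unique morphism from the initial operad has the left lifting
property with respect to the acyclic fibrations, that is, to the morphisms of operads which are
surjective and quasi-isomorphisms in each arity. -/
def IsCofibrant (E : DGOperad) : Prop :=
  ∀ (P Q : DGOperad) (π : P ⟶ Q), (∀ n i, Function.Surjective ((π.app n).f i).hom) →
    (∀ n, QuasiIso (π.app n)) → ∀ f : E ⟶ Q, ∃ g : E ⟶ P, g ≫ π = f

/-- The action of the symmetric group on the operations of a given arity and degree. -/
def permRep (E : DGOperad) (n : ℕ) (p : ℤ) :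
    Representation ℤ (Equiv.Perm (Fin n)) ((E.obj n).X p) where
  toFun σ := ((E.map σ).f p).hom
  map_one' := by
    change ((E.map (Equiv.refl (Fin n))).f p).hom = 1
    rw [E.map_refl]
    rfl
  map_mul' σ τ := by
    change ((E.map (Equiv.trans τ σ)).f p).hom = _
    rw [E.map_trans]
    rfl

/-- A morphism from `E` to the operad of commutative algebras (which is `ℤ` in degree `0`, with the
trivial action, in each arity) that is a quasi-isomorphism in each arity. -/
structure AcyclicAugmentation (E : DGOperad) where
  ε (n : ℕ) : (E.obj n).X 0 →ₗ[ℤ] ℤ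
  ε_d (n : ℕ) (x : (E.obj n).X (-1)) : ε n (((E.obj n).d (-1) 0).hom x) = 0
  ε_map {n m : ℕ} (σ : Fin n ≃ Fin m) (x : (E.obj n).X 0) : ε m (((E.map σ).f 0).hom x) = ε n x
  ε_one : ε 1 E.one = 1
  ε_comp {n : ℕ} (k : Fin n → ℕ) (x : (E.obj n).X 0) (y : ∀ j, (E.obj (k j)).X 0) :
    ε (∑ j, k j) (E.comp k 0 (fun _ => 0) 0 (by simp) x y) = ε n x * ∏ j, ε (k j) (y j)
  exactAt (n : ℕ) (i : ℤ) (hi : i ≠ 0) : (E.obj n).ExactAt i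
  exists_cocycle (n : ℕ) : ∃ x, ((E.obj n).d 0 1).hom x = 0 ∧ ε n x = 1
  exists_boundary (n : ℕ) (x : (E.obj n).X 0) (hx : ((E.obj n).d 0 1).hom x = 0)
    (hε : ε n x = 0) : ∃ y, ((E.obj n).d (-1) 0).hom y = x

/-- An `E∞` operad: it is quasi-isomorphic to the operad of commutative algebras by an augmentation,
and its operations of arity `n` form a complex of projective `ℤ[Σₙ]`-modules. -/
structure IsEInfinity (E : DGOperad) : Prop where
  augmentation : Nonempty E.AcyclicAugmentation
  projective (n : ℕ) (p : ℤ) :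
    Module.Projective (MonoidAlgebra ℤ (Equiv.Perm (Fin n))) (E.permRep n p).asModule

/-- The structure of an `E`-algebra on a complex: `act p q r h x a` is the value of the operation
`x` of degree `p` on the elements `a j` of degree `q j`. -/
structure AlgStruct (E : DGOperad) (A : Cplx) where
  act {n : ℕ} (p : ℤ) (q : Fin n → ℤ) (r : ℤ) (h : p + ∑ j, q j = r) :
    (E.obj n).X p →ₗ[ℤ] MultilinearMap ℤ (fun j => A.X (q j)) (A.X r)
  d_act {n : ℕ} (p : ℤ) (q : Fin n → ℤ) (r : ℤ) (h : p + ∑ j, q j = r)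
    (x : (E.obj n).X p) (a : ∀ j, A.X (q j)) :
    (A.d r (r + 1)).hom (act p q r h x a) =
      act (p + 1) q (r + 1) (degree_d h) (((E.obj n).d p (p + 1)).hom x) a +
      ∑ j, (p + ∑ i ∈ Finset.Iio j, q i).negOnePow •
        act p (raise q j) (r + 1) (degree_dAt h j) x (dAt (fun _ => A) q j a)
  one_act (q : ℤ) (a : A.X q) :
    act (n := 1) 0 (fun _ => q) q (by simp) E.one (fun _ => a) = a
  comp_act {n : ℕ} (k : Fin n → ℕ)
    (p : ℤ) (s : Fin n → ℤ) (q : Fin (∑ j, k j) → ℤ) (u : ℤ) (v : Fin n → ℤ) (r : ℤ)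
    (hu : p + ∑ j, s j = u) (hr : u + ∑ l, q l = r)
    (hv : ∀ j, s j + ∑ i, q (finSigmaFinEquiv ⟨j, i⟩) = v j) (hr' : p + ∑ j, v j = r)
    (x : (E.obj n).X p) (y : ∀ j, (E.obj (k j)).X (s j)) (a : ∀ l, A.X (q l)) :
    act u q r hr (E.comp k p s u hu x y) a =
      shuffleSign s (fun j => ∑ i, q (finSigmaFinEquiv ⟨j, i⟩)) •
        act p v r hr' x fun j =>
          act (s j) (fun i => q (finSigmaFinEquiv ⟨j, i⟩)) (v j) (hv j) (y j)
            fun i => a (finSigmaFinEquiv ⟨j, i⟩)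
  map_act {n m : ℕ} (σ : Fin n ≃ Fin m) (p : ℤ) (q : Fin m → ℤ) (r : ℤ) (h : p + ∑ j, q j = r)
    (x : (E.obj n).X p) (a : ∀ j, A.X (q j)) :
    act p q r h (((E.map σ).f p).hom x) a =
      permSign σ q • act p (fun j => q (σ j)) r (degree_perm h σ) x (fun j => a (σ j))

/-- A chain map is a morphism of `E`-algebras if it commutes with all operations. -/
def IsAlgHom {E : DGOperad} {A B : Cplx} (α : E.AlgStruct A) (β : E.AlgStruct B) (f : A ⟶ B) :
    Prop :=
  ∀ {n : ℕ} (p : ℤ) (q : Fin n → ℤ) (r : ℤ) (h : p + ∑ j, q j = r)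
    (x : (E.obj n).X p) (a : ∀ j, A.X (q j)),
    (f.f r).hom (α.act p q r h x a) = β.act p q r h x (fun j => (f.f (q j)).hom (a j))

/-- The objects of the category of `E`-algebras. -/
structure Alg (E : DGOperad) where
  cplx : Cplx
  str : E.AlgStruct cplx

/-- Morphisms of `E`-algebras. -/
@[ext]
structure Alg.Hom {E : DGOperad} (A B : E.Alg) where
  hom : A.cplx ⟶ B.cplx
  isAlgHom : IsAlgHom A.str B.str hom

instance (E : DGOperad) : Category E.Alg where
  Hom := Alg.Hom
  id A := ⟨𝟙 A.cplx, fun p q r h x a => by simp⟩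
  comp f g := ⟨f.hom ≫ g.hom, fun p q r h x a => by
    simp [f.isAlgHom p q r h x a, g.isAlgHom p q r h]⟩

/-- An `E`-algebra is cofibrant if its unique morphism from the initial `E`-algebra has the left
lifting property with respect to the acyclic fibrations, that is, to the morphisms of `E`-algebras
which are surjective quasi-isomorphisms. -/
def Alg.IsCofibrant {E : DGOperad} (A : E.Alg) : Prop :=
  ∀ (B C : E.Alg) (π : B ⟶ C), (∀ i, Function.Surjective (π.hom.f i).hom) →
    QuasiIso π.hom → ∀ f : A ⟶ C, ∃ g : A ⟶ B, g ≫ π = f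

end DGOperad

/-! ### Normalized cochains -/

/-- The functions to `R` on the `n`-simplices of `X`, for `n = q` (so there is only one if `q < 0`). -/
abbrev SimplexFun (X : SSet.{0}) (R : Type) (q : ℤ) : Type :=
  ∀ n : {n : ℕ // (n : ℤ) = q}, X _⦋n.1⦌ → R

/-- The normalized cochains of degree `q` on `X` with coefficients in `R`: the functions to `R` on
the `q`-simplices that vanish on the degenerate simplices. -/
def normCochains (X : SSet.{0}) (R : Type) [CommRing R] (q : ℤ) :
    Submodule ℤ (SimplexFun X R q) where
  carrier := {f | ∀ n (x : X _⦋n.1⦌), x ∈ X.degenerate n.1 → f n x = 0}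
  add_mem' hf hg n x hx := by simp [hf n x hx, hg n x hx]
  zero_mem' n x hx := rfl
  smul_mem' c f hf n x hx := by simp [hf n x hx]

namespace normCochains

/-- The coboundary: the alternating sum of the values of `f` on the faces of a simplex. -/
def dFun {X : SSet.{0}} {R : Type} [CommRing R] {i j : ℤ} (hij : i + 1 = j)
    (f : SimplexFun X R i) : SimplexFun X R j :=
  fun n => match n with
    | ⟨0, _⟩ => fun _ => 0
    | ⟨n + 1, h⟩ => fun x =>
        ∑ k : Fin (n + 2), (-1 : ℤ) ^ (k : ℕ) • f ⟨n, by omega⟩ (X.δ k x)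

lemma dFun_mem {X : SSet.{0}} {R : Type} [CommRing R] {i j : ℤ} (hij : i + 1 = j)
    (f : SimplexFun X R i) (hf : f ∈ normCochains X R i) :
    dFun hij f ∈ normCochains X R j := by
  rintro ⟨n, h⟩ x hx
  obtain _ | n := n
  · rfl
  rw [SSet.degenerate_eq_iUnion_range_σ, Set.mem_iUnion] at hx
  obtain ⟨a, y, rfl⟩ := hx
  change ∑ k : Fin (n + 2), (-1 : ℤ) ^ (k : ℕ) • f ⟨n, by omega⟩ (X.δ k (X.σ a y)) = 0
  have key (k : Fin (n + 2)) (h₁ : k ≠ a.castSucc) (h₂ : k ≠ a.succ) :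
      f ⟨n, by omega⟩ (X.δ k (X.σ a y)) = 0 := by
    apply hf
    obtain _ | n := n
    · exfalso
      fin_cases a
      fin_cases k
      · exact h₁ rfl
      · exact h₂ rfl
    · obtain h₃ | h₃ := lt_or_gt_of_ne h₁
      · obtain ⟨a, rfl⟩ := Fin.exists_succ_eq.2 (show a ≠ 0 by rintro rfl; simp at h₃)
        obtain ⟨k, rfl⟩ := Fin.exists_castSucc_eq.2
          (show k ≠ Fin.last _ from (h₃.trans_le (Fin.le_last _)).ne)
        have h₄ : k ≤ a.castSucc := by
          simp only [Fin.lt_def, Fin.le_def, Fin.val_castSucc, Fin.val_succ] at h₃ ⊢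
          omega
        exact (congrArg (· ∈ X.degenerate (n + 1)) (SSet.δ_comp_σ_of_le_apply h₄ y)).mpr
          (X.σ_mem_degenerate _ _)
      · have h₄ : a.succ < k := by
          simp only [Fin.lt_def, Fin.ext_iff, Fin.val_castSucc, Fin.val_succ, ne_eq] at h₂ h₃ ⊢
          omega
        exact (congrArg (· ∈ X.degenerate (n + 1)) (SSet.δ_comp_σ_of_gt'_apply h₄ y)).mpr
          (X.σ_mem_degenerate _ _)
  rw [Fintype.sum_eq_add a.castSucc a.succ (by simp [Fin.ext_iff])
    (fun k hk => by rw [key k hk.1 hk.2, smul_zero])]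
  rw [SSet.δ_comp_σ_self_apply, SSet.δ_comp_σ_succ_apply]
  simp [pow_succ]

lemma dFun_dFun {X : SSet.{0}} {R : Type} [CommRing R] {i j k : ℤ} (hij : i + 1 = j)
    (hjk : j + 1 = k) (f : SimplexFun X R i) :
    dFun hjk (dFun hij f) = 0 := by
  funext n x
  obtain ⟨_ | _ | n, h⟩ := n
  · rfl
  · change ∑ l : Fin 2, (-1 : ℤ) ^ (l : ℕ) • (0 : R) = 0
    simp
  change ∑ b : Fin (n + 3), (-1 : ℤ) ^ (b : ℕ) • ∑ a : Fin (n + 2), (-1 : ℤ) ^ (a : ℕ) •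
    f ⟨n, by omega⟩ (X.δ a (X.δ b x)) = 0
  simp only [Finset.smul_sum, smul_smul]
  rw [Finset.sum_comm, ← Finset.sum_product', Finset.univ_product_univ]
  let S : Finset (Fin (n + 2) × Fin (n + 3)) := {ab | (ab.2 : ℕ) ≤ (ab.1 : ℕ)}
  rw [← Finset.sum_add_sum_compl S, ← eq_neg_iff_add_eq_zero, ← Finset.sum_neg_distrib]
  let φ : ∀ ab : Fin (n + 2) × Fin (n + 3), ab ∈ S → Fin (n + 2) × Fin (n + 3) := fun ab hab =>
    (Fin.castLT ab.2 (lt_of_le_of_lt (Finset.mem_filter.mp hab).right (Fin.is_lt ab.1)), ab.1.succ)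
  apply Finset.sum_bij φ
  · intro ab hab
    simp_rw [S, φ, Finset.compl_filter, Finset.mem_filter_univ, Fin.val_succ,
      Fin.val_castLT] at hab ⊢
    omega
  · rintro ⟨a, b⟩ hab ⟨a', b'⟩ hab' h
    simp only [φ, Prod.mk.injEq, Fin.ext_iff, Fin.val_castLT, Fin.val_succ] at h ⊢
    omega
  · rintro ⟨a', b'⟩ hab'
    simp_rw [S, Finset.compl_filter, Finset.mem_filter_univ, not_le] at hab'
    refine ⟨(⟨b' - 1, by omega⟩, a'.castSucc), ?_, ?_⟩
    · simp only [S, Finset.mem_filter_univ, Fin.val_castSucc]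
      omega
    · simp only [φ, Prod.mk.injEq, Fin.ext_iff, Fin.val_castLT, Fin.val_succ, Fin.val_castSucc,
        true_and]
      omega
  · rintro ⟨a, b⟩ hab
    have hab' : b ≤ a.castSucc := by simpa [S, Fin.le_def] using hab
    simp only [φ, Fin.val_succ, Fin.val_castLT]
    rw [← neg_smul]
    congr 1
    · ring
    · exact congrArg _ (SSet.δ_comp_δ''_apply hab' x).symm

/-- The differential of the complex of normalized cochains. -/
def d (X : SSet.{0}) (R : Type) [CommRing R] {i j : ℤ} (hij : i + 1 = j) :
    normCochains X R i →ₗ[ℤ] normCochains X R j where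
  toFun f := ⟨dFun hij f.1, dFun_mem hij f.1 f.2⟩
  map_add' f g := by
    ext ⟨_ | n, h⟩ x
    · simp [dFun]
    · simp [dFun, Finset.sum_add_distrib]
  map_smul' c f := by
    ext ⟨_ | n, h⟩ x
    · simp [dFun]
    · simp [dFun, Finset.mul_sum, mul_left_comm]

/-- Restriction along a morphism of simplicial sets and change of coefficients. -/
def map {X Y : SSet.{0}} {R S : Type} [CommRing R] [CommRing S] (g : X ⟶ Y) (φ : R →+* S) (q : ℤ) :
    normCochains Y R q →ₗ[ℤ] normCochains X S q where
  toFun f := ⟨fun n x => φ (f.1 n (g.app _ x)), fun n x hx => by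
    change φ (f.1 n (g.app _ x)) = 0
    rw [f.2 n _ (SSet.degenerate_app_apply hx g), map_zero]⟩
  map_add' f f' := by ext; simp
  map_smul' c f := by ext; simp

end normCochains

/-- The complex `C^*(X; R)` of normalized cochains. -/
def cochainCplx (X : SSet.{0}) (R : Type) [CommRing R] : Cplx where
  X q := ModuleCat.of ℤ (normCochains X R q)
  d i j := if hij : i + 1 = j then ModuleCat.ofHom (normCochains.d X R hij) else 0
  shape i j hij := dif_neg hij
  d_comp_d' i j k hij hjk := by
    obtain rfl : i + 1 = j := hij
    obtain rfl : i + 1 + 1 = k := hjk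
    ext f
    simp only [dif_pos]
    exact congrFun (congrFun (normCochains.dFun_dFun rfl rfl (Subtype.val f)) _) _

/-- The functoriality of the complex of normalized cochains. -/
def cochainMap {X Y : SSet.{0}} {R S : Type} [CommRing R] [CommRing S] (g : X ⟶ Y) (φ : R →+* S) :
    cochainCplx Y R ⟶ cochainCplx X S where
  f q := ModuleCat.ofHom (normCochains.map g φ q)
  comm' i j hij := by
    obtain rfl : i + 1 = j := hij
    ext f
    refine Subtype.ext (funext fun n => funext fun x => ?_)
    obtain ⟨_ | n, h⟩ := n
    · simp only [cochainCplx, dif_pos]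
      exact (map_zero φ).symm
    · simp only [cochainCplx, dif_pos]
      change ∑ k : Fin (n + 2), (-1 : ℤ) ^ (k : ℕ) • φ (Subtype.val f ⟨n, _⟩ (g.app _ (X.δ k x))) =
        φ (∑ k : Fin (n + 2), (-1 : ℤ) ^ (k : ℕ) • Subtype.val f ⟨n, _⟩ (Y.δ k (g.app _ x)))
      simp only [map_sum, map_zsmul]
      refine Finset.sum_congr rfl fun k _ => ?_
      rw [SSet.δ_naturality_apply]

/-- A natural structure of `E`-algebra on the normalized cochains `C^*(X; R)`, where `X` runs
through the simplicial sets and `R` through the commutative rings; in other words, a lift of the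
functor `C^*(-; -)` from complexes to `E`-algebras. -/
structure CochainAction (E : DGOperad) where
  str (X : SSet.{0}) (R : Type) [CommRing R] : E.AlgStruct (cochainCplx X R)
  natural {X Y : SSet.{0}} {R S : Type} [CommRing R] [CommRing S] (g : X ⟶ Y) (φ : R →+* S) :
    DGOperad.IsAlgHom (str Y R) (str X S) (cochainMap g φ)

namespace CochainAction

variable {E : DGOperad} (θ : CochainAction E)

/-- The `E`-algebra `C^*(X; R)`, as a functor of the commutative ring `R` and (contravariantly) of
the simplicial set `X`. -/
def cochainAlg : CommRingCat.{0} ⥤ SSet.{0}ᵒᵖ ⥤ E.Alg where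
  obj R :=
    { obj := fun X => ⟨cochainCplx X.unop R, θ.str X.unop R⟩
      map := fun g => ⟨cochainMap g.unop (RingHom.id R), θ.natural _ _⟩
      map_id := fun _ => rfl
      map_comp := fun _ _ => rfl }
  map φ :=
    { app := fun X => ⟨cochainMap (𝟙 X.unop) φ.hom, θ.natural _ _⟩
      naturality := fun _ _ _ => rfl }
  map_id _ := rfl
  map_comp _ _ := rfl

/-- The simplicial set `T(A; R)` of morphisms of `E`-algebras from `A` to `C^*(Δ[•]; R)`,
as a functor of the commutative ring `R`. -/
def T (A : E.Alg) : CommRingCat.{0} ⥤ SSet.{0} :=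
  θ.cochainAlg ⋙ (Functor.whiskeringLeft _ _ _).obj SSet.stdSimplex.op ⋙
    (Functor.whiskeringRight _ _ _).obj (coyoneda.obj (op A))

end CochainAction

/-! ### The arithmetic square of rings -/

instance (p : Nat.Primes) : Fact (p : ℕ).Prime := ⟨p.2⟩

/-- The finite completion of the integers: the product of the `p`-adic integers over all primes. -/
abbrev ZHat : Type := ∀ p : Nat.Primes, ℤ_[p]

open scoped TensorProduct in
/-- The ring `ZHat ⊗ ℚ`. -/
abbrev QHat : Type := ZHat ⊗[ℤ] ℚ

/-- The inclusion of `ZHat` in `QHat`. -/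
def zHatToQHat : CommRingCat.of ZHat ⟶ CommRingCat.of QHat :=
  CommRingCat.ofHom (Algebra.TensorProduct.includeLeftRingHom)

/-- The inclusion of `ℚ` in `QHat`. -/
def ratToQHat : CommRingCat.of ℚ ⟶ CommRingCat.of QHat :=
  CommRingCat.ofHom (Algebra.TensorProduct.includeRight (R := ℤ) (A := ZHat) (B := ℚ)).toRingHom

/-- The inclusion of `ℤ` in `ZHat`. -/
def intToZHat : CommRingCat.of ℤ ⟶ CommRingCat.of ZHat :=
  CommRingCat.ofHom (Int.castRingHom ZHat)

/-- The inclusion of `ℤ` in `ℚ`. -/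
def intToRat : CommRingCat.of ℤ ⟶ CommRingCat.of ℚ :=
  CommRingCat.ofHom (Int.castRingHom ℚ)

/-! ### Homotopy cartesian squares of simplicial sets -/

/-- The set of homotopy classes of morphisms from `X` to `K` (this is used for Kan complexes `K`,
where simplicial homotopy is an equivalence relation). -/
def HomotopyClasses (X K : SSet.{0}) : Type :=
  Quot fun f g : X ⟶ K => Nonempty (SSet.Homotopy f g)

/-- The map induced on homotopy classes by precomposition. -/
def HomotopyClasses.precomp {X Y : SSet.{0}} (f : X ⟶ Y) (K : SSet.{0}) :
    HomotopyClasses Y K → HomotopyClasses X K :=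
  Quot.map (fun g => f ≫ g) fun _ _ ⟨H⟩ =>
    ⟨SSet.RelativeMorphism.Homotopy.precomp H (SSet.RelativeMorphism.botEquiv.symm f)
      (SSet.Subcomplex.isInitialBot.hom_ext _ _)⟩

/-- A morphism of simplicial sets is a weak equivalence if it induces a bijection on homotopy
classes of morphisms to each Kan complex. -/
def IsWeakEquivalence {X Y : SSet.{0}} (f : X ⟶ Y) : Prop :=
  ∀ (K : SSet.{0}) [SSet.KanComplex K], Function.Bijective (HomotopyClasses.precomp f K)

/-- The commutative square with sides `f : W ⟶ X`, `g : W ⟶ Y`, `h : X ⟶ Z`, `k : Y ⟶ Z` is homotopy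
cartesian: the cospan `X ⟶ Z ⟵ Y` can be replaced by a weakly equivalent cospan of Kan fibrations
`X' ⟶ Z' ⟵ Y'` over a Kan complex `Z'` such that the induced morphism from `W` to the pullback
of `X'` and `Y'` over `Z'` is a weak equivalence. -/
def IsHomotopyCartesian {W X Y Z : SSet.{0}} (f : W ⟶ X) (g : W ⟶ Y) (h : X ⟶ Z) (k : Y ⟶ Z) :
    Prop :=
  ∃ (w : f ≫ h = g ≫ k) (X' Y' Z' : SSet.{0}) (x : X ⟶ X') (y : Y ⟶ Y') (z : Z ⟶ Z')
    (p : X' ⟶ Z') (q : Y' ⟶ Z') (hp : x ≫ p = h ≫ z) (hq : y ≫ q = k ≫ z),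
    IsWeakEquivalence x ∧ IsWeakEquivalence y ∧ IsWeakEquivalence z ∧
    SSet.KanComplex Z' ∧ Fibration p ∧ Fibration q ∧
    IsWeakEquivalence (pullback.lift (f ≫ x) (g ≫ y)
      (by rw [Category.assoc, Category.assoc, hp, hq, reassoc_of% w]) : W ⟶ pullback p q)

end

/-!
A space of morphisms `T(A; R)` with constant coefficients is a special case of the simplicial set
of morphisms from `A` to the cochains on `Δ[n] ⊗ K` whose value at a simplex lies in a subring
which depends on its image in `K`. Such cochains form a subalgebra for every natural action of the
operad, because the value of an operation at a simplex can be computed after restriction to that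
simplex.

Write `P`, `Q` and `S` for the three rings in the cospan, with `P` and `Q` subrings of `S`. The
minimum contracts `Δ[1]` to its vertex `0`, so `T(A; P)` is weakly equivalent to the space of paths,
`K = Δ[1]`, with coefficients `P` at the vertex `0` and `S` elsewhere. Likewise `T(A; Q)` is
replaced by a space of paths, and `T(A; P ∩ Q)` by the space for `K = Δ[1] ⊗ Δ[1]` with the
intersection of the two systems of coefficients. Since `A` is cofibrant, a morphism to cochains on a
subcomplex extends whenever the relative cochains are acyclic. For horns this shows that the
evaluations at the end `1` of the paths are Kan fibrations over a Kan complex. For the square the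
relative cochains are acyclic because `P + Q = S`, so the map from its space to the pullback of the
two spaces of paths has the right lifting property with respect to all monomorphisms.
-/

noncomputable section

/-! ### Subalgebras of algebras over an operad -/

/-- A homomorphism of abelian groups as a linear map, for arbitrary (propositionally, but not
definitionally unique) structures of modules over the integers. -/
def addMonoidHomToLinearMap {M N : Type*} [AddCommGroup M] [Module ℤ M] [AddCommGroup N]
    [Module ℤ N] (f : M →+ N) : M →ₗ[ℤ] N where
  toFun := f
  map_add' := map_add f
  map_smul' c x := by simpa using map_intCast_smul f ℤ ℤ c x

lemma map_dAt {n : ℕ} {F G : Fin n → Cplx} (φ : ∀ i, F i ⟶ G i) (q : Fin n → ℤ) (j : Fin n)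
    (a : ∀ i, (F i).X (q i)) (i : Fin n) :
    ((φ i).f (raise q j i)).hom (dAt F q j a i) =
      dAt G q j (fun i => ((φ i).f (q i)).hom (a i)) i := by
  by_cases h : i = j
  · have hF : dAt F q j a i = ((F i).d (q i) (raise q j i)).hom (a i) := dif_pos h
    have hG : dAt G q j (fun i => ((φ i).f (q i)).hom (a i)) i =
        ((G i).d (q i) (raise q j i)).hom (((φ i).f (q i)).hom (a i)) := dif_pos h
    rw [hF, hG]
    exact (ConcreteCategory.congr_hom ((φ i).comm (q i) (raise q j i)) (a i)).symm
  · have hr : q i = raise q j i := (if_neg h : raise q j i = q i).symm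
    have hF : dAt F q j a i = ((F i).XIsoOfEq hr).hom.hom (a i) := dif_neg h
    have hG : dAt G q j (fun i => ((φ i).f (q i)).hom (a i)) i =
        ((G i).XIsoOfEq hr).hom.hom (((φ i).f (q i)).hom (a i)) := dif_neg h
    rw [hF, hG]
    exact ConcreteCategory.congr_hom (HomologicalComplex.XIsoOfEq_hom_naturality (φ i) hr).symm
      (a i)

section

-- Submodules must carry the restricted structures of modules, not those of abelian groups.
attribute [local instance 10] AddCommGroup.toIntModule

variable (B : Cplx) (N : ∀ q, Submodule ℤ (B.X q))
  (hd : ∀ i j, ∀ b ∈ N i, (B.d i j).hom b ∈ N j)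

/-- The subcomplex given by submodules which are stable under the differential. -/
def subCplx : Cplx where
  X q := ModuleCat.of ℤ (N q)
  d i j := ModuleCat.ofHom ((B.d i j).hom.restrict (hd i j))
  shape i j hij := ModuleCat.hom_ext (LinearMap.ext fun b => Subtype.ext
    (ConcreteCategory.congr_hom (B.shape i j hij) b.1))
  d_comp_d' i j k _ _ := ModuleCat.hom_ext (LinearMap.ext fun b => Subtype.ext
    (ConcreteCategory.congr_hom (B.d_comp_d i j k) b.1))

/-- The inclusion of a subcomplex. -/
def subCplxι : subCplx B N hd ⟶ B where
  f q := ModuleCat.ofHom (N q).subtype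
  comm' _ _ _ := rfl

namespace DGOperad

variable {B N} {E : DGOperad} (β : E.AlgStruct B)
  (hN : ∀ {n : ℕ} (p : ℤ) (q : Fin n → ℤ) (r : ℤ) (h : p + ∑ j, q j = r) (x : (E.obj n).X p)
    (a : ∀ j, B.X (q j)), (∀ j, a j ∈ N (q j)) → β.act p q r h x a ∈ N r)

/-- The operations of an algebra, restricted to submodules which are stable under them. -/
def AlgStruct.restrictAct {n : ℕ} (p : ℤ) (q : Fin n → ℤ) (r : ℤ) (h : p + ∑ j, q j = r) :
    (E.obj n).X p →+ MultilinearMap ℤ (fun j => N (q j)) (N r) where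
  toFun x := ((β.act p q r h x).compLinearMap fun j => (N (q j)).subtype).codRestrict (N r)
    fun a => hN p q r h x _ fun j => (a j).2
  map_zero' := MultilinearMap.ext fun _ => Subtype.ext
    (congrFun (congrArg DFunLike.coe (map_zero (β.act p q r h))) _)
  map_add' x y := MultilinearMap.ext fun _ => Subtype.ext
    (congrFun (congrArg DFunLike.coe (map_add (β.act p q r h) x y)) _)

/-- The algebra structure on a subcomplex which is stable under all operations. -/
def AlgStruct.restrict : E.AlgStruct (subCplx B N hd) where
  act p q r h := @addMonoidHomToLinearMap _ _ _ _ _ (AddCommGroup.toIntModule _)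
    (β.restrictAct hN p q r h)
  d_act {n} p q r h x a := by
    have hι : Function.Injective ((subCplxι B N hd).f (r + 1)).hom := Subtype.val_injective
    apply hι
    rw [map_add, map_sum]
    refine (β.d_act p q r h x fun j => (a j).1).trans (congrArg₂ (· + ·) rfl ?_)
    refine Finset.sum_congr rfl fun j _ => congrArg _ (congrArg _ (funext fun i => ?_))
    exact (map_dAt (fun _ => subCplxι B N hd) q j a i).symm
  one_act q a := Subtype.ext (β.one_act q a.1)
  comp_act k p s q u v r hu hr hv hr' x y a :=
    Subtype.ext (β.comp_act k p s q u v r hu hr hv hr' x y fun l => (a l).1)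
  map_act σ p q r h x a := Subtype.ext (β.map_act σ p q r h x fun l => (a l).1)

end DGOperad

end

/-! ### Quasi-isomorphisms -/

lemma quasiIso_of_shortExact_of_acyclic {S : ShortComplex Cplx} (hS : S.ShortExact)
    (h : S.X₁.Acyclic) : QuasiIso S.g := by
  refine (quasiIso_iff _).2 fun i => ?_
  rw [quasiIsoAt_iff_isIso_homologyMap]
  have : Mono (HomologicalComplex.homologyMap S.g i) :=
    (hS.homology_exact₂ i).mono_g ((h i).isZero_homology.eq_of_src _ _)
  have : Epi (HomologicalComplex.homologyMap S.g i) :=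
    (hS.homology_exact₃ i (i + 1) rfl).epi_f ((h (i + 1)).isZero_homology.eq_of_tgt _ _)
  exact isIso_of_mono_of_epi (HomologicalComplex.homologyMap S.g i)

lemma quasiIso_of_surjective {B C : Cplx} (π : B ⟶ C)
    (hπ : ∀ i, Function.Surjective (π.f i).hom)
    (hker : ∀ i j k, i + 1 = j → j + 1 = k → ∀ b : B.X j, (π.f j).hom b = 0 →
      (B.d j k).hom b = 0 → ∃ a : B.X i, (π.f i).hom a = 0 ∧ (B.d i j).hom a = b) :
    QuasiIso π := by
  let S : ShortComplex Cplx := ShortComplex.mk (kernel.ι π) π (kernel.condition π)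
  have : ∀ i, Epi (π.f i) := fun i => (ModuleCat.epi_iff_surjective _).2 (hπ i)
  have : Epi π := HomologicalComplex.epi_of_epi_f π this
  have hS : S.ShortExact := { exact := ShortComplex.exact_kernel π }
  have hSj (j : ℤ) : (S.map (HomologicalComplex.eval _ _ j)).ShortExact :=
    hS.map_of_exact (HomologicalComplex.eval _ _ j)
  refine quasiIso_of_shortExact_of_acyclic hS fun j => ?_
  rw [HomologicalComplex.exactAt_iff' _ (j - 1) j (j + 1) (by simp) (by simp),
    ShortComplex.moduleCat_exact_iff]
  intro x hx
  have hπx : (π.f j).hom ((S.f.f j).hom x) = 0 :=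
    ConcreteCategory.congr_hom (S.map (HomologicalComplex.eval _ _ j)).zero x
  have hdx : (B.d j (j + 1)).hom ((S.f.f j).hom x) = 0 :=
    (ConcreteCategory.congr_hom (S.f.comm j (j + 1)) x).trans
      ((congrArg (S.f.f (j + 1)).hom hx).trans (map_zero _))
  obtain ⟨a, ha, hax⟩ := hker (j - 1) j (j + 1) (by omega) rfl _ hπx hdx
  obtain ⟨y, rfl⟩ := (ShortComplex.moduleCat_exact_iff _).1 (hSj (j - 1)).exact a ha
  have hinj : Function.Injective (S.f.f j).hom :=
    (ModuleCat.mono_iff_injective _).1 (hSj j).mono_f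
  exact ⟨y, hinj ((ConcreteCategory.congr_hom (S.f.comm (j - 1) j) y).symm.trans hax)⟩

/-! ### Normalized cochains and simplicial homotopies -/

namespace normCochains

section

variable {X Y : SSet.{0}} {S : Type} [CommRing S]

lemma ext_apply {q : ℤ} {f g : normCochains Y S q} (h : ∀ n y, f.1 n y = g.1 n y) : f = g :=
  Subtype.ext (funext fun n => funext fun y => h n y)

lemma d_apply {i j : ℤ} (hij : i + 1 = j) (f : normCochains Y S i) (n : ℕ)
    (hn : ((n + 1 : ℕ) : ℤ) = j) (y : Y _⦋n + 1⦌) :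
    (d Y S hij f).1 ⟨n + 1, hn⟩ y =
      ∑ k : Fin (n + 2), (-1 : ℤ) ^ (k : ℕ) • f.1 ⟨n, by omega⟩ (Y.δ k y) :=
  rfl

lemma d_d {i j k : ℤ} (hij : i + 1 = j) (hjk : j + 1 = k) (f : normCochains Y S i) :
    d Y S hjk (d Y S hij f) = 0 :=
  Subtype.ext (dFun_dFun hij hjk f.1)

/-- The restriction of cochains along a morphism of simplicial sets. -/
def restrict (g : X ⟶ Y) {q : ℤ} (c : normCochains Y S q) : normCochains X S q :=
  map g (RingHom.id S) q c

lemma restrict_sub (g : X ⟶ Y) {q : ℤ} (c c' : normCochains Y S q) :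
    restrict g (c - c') = restrict g c - restrict g c' :=
  map_sub (map g (RingHom.id S) q) c c'

lemma restrict_d (g : X ⟶ Y) {i j : ℤ} (hij : i + 1 = j) (c : normCochains Y S i) :
    restrict g (d Y S hij c) = d X S hij (restrict g c) := by
  have h := ConcreteCategory.congr_hom ((cochainMap g (RingHom.id S)).comm i j) c
  subst hij
  simp only [cochainCplx, dif_pos] at h
  exact h.symm

end

end normCochains

section

variable {X Y : SSet.{0}} {f g : X ⟶ Y}

lemma homotopy_mem_degenerate (H : SimplicialObject.Homotopy f g) {n : ℕ} (k : Fin (n + 1))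
    {x : X _⦋n⦌} (hx : x ∈ X.degenerate n) : H.h k x ∈ Y.degenerate (n + 1) := by
  obtain _ | n := n
  · simp at hx
  rw [SSet.degenerate_eq_iUnion_range_σ, Set.mem_iUnion] at hx
  obtain ⟨i, z, rfl⟩ := hx
  by_cases h : k ≤ i.castSucc
  · obtain ⟨j, rfl⟩ := Fin.exists_castSucc_eq.2
      (show k ≠ Fin.last _ from (h.trans_lt (Fin.castSucc_lt_last i)).ne)
    have hσ : Y.σ i.succ (H.h j z) = H.h j.castSucc (X.σ i z) :=
      ConcreteCategory.congr_hom (H.h_comp_σ_succ_of_lt i j (by simpa using h)) z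
    exact hσ ▸ Y.σ_mem_degenerate _ _
  · obtain ⟨j, rfl⟩ := Fin.exists_succ_eq.2 (show k ≠ 0 by rintro rfl; simp at h)
    have hji : i.castSucc ≤ j.castSucc := by
      simp only [Fin.le_def, Fin.val_succ, Fin.val_castSucc] at h ⊢
      omega
    have hσ : Y.σ i.castSucc (H.h j z) = H.h j.succ (X.σ i z) :=
      ConcreteCategory.congr_hom (H.h_comp_σ_castSucc_of_le i j hji) z
    exact hσ ▸ Y.σ_mem_degenerate _ _

lemma free_map_eq_of_homotopy (H : SimplicialObject.Homotopy f g) (n : ℕ) :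
    (ModuleCat.free ℤ).map (f.app (op ⦋n + 1⦌)) =
      (∑ j : Fin (n + 2), (-1 : ℤ) ^ (j : ℕ) • (ModuleCat.free ℤ).map (X.δ j)) ≫
        (- ∑ k : Fin (n + 1), (-1 : ℤ) ^ (k : ℕ) • (ModuleCat.free ℤ).map (H.h k)) +
      (- ∑ k : Fin (n + 2), (-1 : ℤ) ^ (k : ℕ) • (ModuleCat.free ℤ).map (H.h k)) ≫
        (∑ j : Fin (n + 3), (-1 : ℤ) ^ (j : ℕ) • (ModuleCat.free ℤ).map (Y.δ j)) +
      (ModuleCat.free ℤ).map (g.app (op ⦋n + 1⦌)) := by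
  have h := (H.whiskerRight (ModuleCat.free ℤ)).toChainHomotopy.comm (n + 1)
  rw [dNext_eq (i' := n) (w := by simp), prevD_eq (j' := n + 2) (w := by simp)] at h
  refine h.trans (congrArg₂ (· + ·) (congrArg₂ (· + ·) (congrArg₂ (· ≫ ·) ?_ ?_)
    (congrArg₂ (· ≫ ·) ?_ ?_)) rfl)
  · exact AlgebraicTopology.alternatingFaceMapComplex_obj_d _ _
  · exact SimplicialObject.Homotopy.ToChainHomotopy.hom_eq _ n
  · exact SimplicialObject.Homotopy.ToChainHomotopy.hom_eq _ (n + 1)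
  · exact AlgebraicTopology.alternatingFaceMapComplex_obj_d _ _

lemma cocycle_apply_eq_of_homotopy {S : Type} [AddCommGroup S] (H : SimplicialObject.Homotopy f g)
    {n : ℕ} (φ : Y _⦋n + 1⦌ → S)
    (hφ : ∀ z : Y _⦋n + 2⦌, ∑ k : Fin (n + 3), (-1 : ℤ) ^ (k : ℕ) • φ (Y.δ k z) = 0)
    (x : X _⦋n + 1⦌) :
    φ (f.app _ x) = ∑ j : Fin (n + 2), (-1 : ℤ) ^ (j : ℕ) •
      (- ∑ k : Fin (n + 1), (-1 : ℤ) ^ (k : ℕ) • φ (H.h k (X.δ j x))) + φ (g.app _ x) := by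
  let Φ : (ModuleCat.free ℤ).obj (Y _⦋n + 1⦌) ⟶ ModuleCat.of ℤ S := ModuleCat.freeDesc (↾φ)
  have hΦ {T : Type} (a : T ⟶ Y _⦋n + 1⦌) (t : T) :
      ((ModuleCat.free ℤ).map a ≫ Φ).hom (ModuleCat.freeMk t) = φ (a t) :=
    (congrArg Φ.hom (ModuleCat.free_map_apply a t)).trans (ModuleCat.freeDesc_apply _ _)
  have hdΦ : (∑ j : Fin (n + 3), (-1 : ℤ) ^ (j : ℕ) • (ModuleCat.free ℤ).map (Y.δ j)) ≫ Φ = 0 := by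
    ext z
    simpa [hΦ, -ModuleCat.hom_comp, Preadditive.sum_comp, Preadditive.zsmul_comp] using hφ z
  have h := LinearMap.congr_fun
    (congrArg ModuleCat.Hom.hom (congrArg (· ≫ Φ) (free_map_eq_of_homotopy H n)))
    (ModuleCat.freeMk x)
  simpa [hdΦ, hΦ, -ModuleCat.hom_comp, Preadditive.add_comp, Preadditive.sum_comp,
    Preadditive.zsmul_comp] using h

end

namespace normCochains

variable {X Y : SSet.{0}} {f g : X ⟶ Y} {S : Type} [CommRing S]

/-- The operator of degree `-1` on normalized cochains which is induced by a simplicial homotopy. -/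
def prism (H : SimplicialObject.Homotopy f g) {i j : ℤ} (hij : i + 1 = j)
    (c : normCochains Y S j) : normCochains X S i :=
  ⟨fun n x => - ∑ l : Fin (n.1 + 1), (-1 : ℤ) ^ (l : ℕ) •
      c.1 ⟨n.1 + 1, by have := n.2; push_cast; omega⟩ (H.h l x),
    fun n x hx => neg_eq_zero.2 (Finset.sum_eq_zero fun l _ => by
      rw [c.2 _ _ (homotopy_mem_degenerate H l hx), smul_zero])⟩

lemma restrict_eq_d_prism_add (H : SimplicialObject.Homotopy f g) {i j k : ℤ} (hij : i + 1 = j)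
    (hjk : j + 1 = k) {c : normCochains Y S j} (hc : d Y S hjk c = 0) :
    restrict f c = d X S hij (prism H hij c) + restrict g c := by
  have hcz (n : ℕ) (hn : (n : ℤ) = j) (z : Y _⦋n + 1⦌) :
      ∑ l : Fin (n + 2), (-1 : ℤ) ^ (l : ℕ) • c.1 ⟨n, hn⟩ (Y.δ l z) = 0 :=
    congrFun (congrFun (congrArg Subtype.val hc) ⟨n + 1, by push_cast; omega⟩) z
  refine ext_apply fun ⟨n, hn⟩ x => ?_
  obtain _ | n := n
  · have hg : Y.δ 0 (H.h 0 x) = g.app _ x :=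
      ConcreteCategory.congr_hom (H.h_zero_comp_δ_zero 0) x
    have hf : Y.δ 1 (H.h 0 x) = f.app _ x :=
      ConcreteCategory.congr_hom (H.h_last_comp_δ_last 0) x
    have hfg := hcz 0 hn (H.h 0 x)
    rw [Fin.sum_univ_two, hf, hg] at hfg
    simp only [Fin.val_zero, Fin.val_one, pow_zero, pow_one, one_smul, neg_smul,
      ← sub_eq_add_neg, sub_eq_zero] at hfg
    calc c.1 ⟨0, hn⟩ (f.app _ x) = c.1 ⟨0, hn⟩ (g.app _ x) :=
          hfg.symm
      _ = 0 + c.1 ⟨0, hn⟩ (g.app _ x) := (zero_add _).symm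
  · exact cocycle_apply_eq_of_homotopy H (c.1 ⟨n + 1, hn⟩) (hcz (n + 1) hn) x

end normCochains

/-! ### Cochains with coefficients in a system of subgroups -/

/-- A system of coefficients on `Y` with values in an ordered set, such as that of the subgroups
or subrings of a ring: the value at a face of a simplex is at most the value at the simplex. -/
structure CoeffSystem (Y : SSet.{0}) (L : Type) [Preorder L] where
  val {n : SimplexCategoryᵒᵖ} : Y.obj n → L
  val_map_le {n m : SimplexCategoryᵒᵖ} (f : n ⟶ m) (y : Y.obj n) : val (Y.map f y) ≤ val y

namespace CoeffSystem

section

variable {X Y : SSet.{0}} {L : Type}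

instance [Preorder L] : LE (CoeffSystem Y L) where
  le τ₀ τ₁ := ∀ {n : SimplexCategoryᵒᵖ} (y : Y.obj n), τ₀.val y ≤ τ₁.val y

instance [SemilatticeInf L] : Min (CoeffSystem Y L) where
  min τ₀ τ₁ :=
    { val := fun y => τ₀.val y ⊓ τ₁.val y
      val_map_le := fun f y => inf_le_inf (τ₀.val_map_le f y) (τ₁.val_map_le f y) }

/-- The constant system of coefficients. -/
def const (Y : SSet.{0}) [Preorder L] (a : L) : CoeffSystem Y L where
  val _ := a
  val_map_le _ _ := le_rfl

/-- The pullback of a system of coefficients. -/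
def comap [Preorder L] (g : X ⟶ Y) (τ : CoeffSystem Y L) : CoeffSystem X L where
  val x := τ.val (g.app _ x)
  val_map_le f x := by
    rw [NatTrans.naturality_apply]
    exact τ.val_map_le f _

variable [CompleteLattice L]

/-- The system of coefficients which is `τ` on a subcomplex and everything outside: the infimum is
over the proofs of `y ∈ B`. -/
def on (B : Y.Subcomplex) (τ : CoeffSystem Y L) : CoeffSystem Y L where
  val {n} y := ⨅ _ : y ∈ B.obj n, τ.val y
  val_map_le f y := le_iInf fun hy => (iInf_le _ (B.map f hy)).trans (τ.val_map_le f y)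

/-- The system of coefficients `τ` relative to a subcomplex, where it becomes zero. -/
def rel (B : Y.Subcomplex) (τ : CoeffSystem Y L) : CoeffSystem Y L :=
  τ ⊓ on B (const Y ⊥)

end

open normCochains

variable {X Y : SSet.{0}} {S : Type} [CommRing S] {q : ℤ} {τ τ₀ τ₁ : CoeffSystem Y (AddSubgroup S)}

/-- The normalized cochains with coefficients in `τ`. -/
def cochains (τ : CoeffSystem Y (AddSubgroup S)) (q : ℤ) : Submodule ℤ (normCochains Y S q) where
  carrier := {f | ∀ n y, f.1 n y ∈ τ.val y}
  zero_mem' _ _ := zero_mem _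
  add_mem' hf hg n y := add_mem (hf n y) (hg n y)
  smul_mem' k _ hf n y := zsmul_mem (hf n y) k

lemma mem_cochains_inf {f : normCochains Y S q} :
    f ∈ (τ₀ ⊓ τ₁).cochains q ↔ f ∈ τ₀.cochains q ∧ f ∈ τ₁.cochains q :=
  ⟨fun hf => ⟨fun n y => (hf n y).1, fun n y => (hf n y).2⟩, fun hf n y => ⟨hf.1 n y, hf.2 n y⟩⟩

lemma mem_cochains_on {B : Y.Subcomplex} {f : normCochains Y S q} :
    f ∈ (on B τ).cochains q ↔ ∀ n y, y ∈ B.obj _ → f.1 n y ∈ τ.val y :=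
  forall₂_congr fun _ _ => AddSubgroup.mem_iInf

lemma mem_cochains_rel {B : Y.Subcomplex} {f : normCochains Y S q} :
    f ∈ (rel B τ).cochains q ↔ f ∈ τ.cochains q ∧ ∀ n y, y ∈ B.obj _ → f.1 n y = 0 :=
  mem_cochains_inf.trans (and_congr_right' mem_cochains_on)

lemma cochains_mono (h : τ₀ ≤ τ₁) : τ₀.cochains q ≤ τ₁.cochains q :=
  fun _ hf n y => h y (hf n y)

lemma cochains_rel_mono (B : Y.Subcomplex) (h : τ₀ ≤ τ₁) :
    (rel B τ₀).cochains q ≤ (rel B τ₁).cochains q :=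
  cochains_mono fun y => inf_le_inf_right _ (h y)

lemma d_mem_cochains {i j : ℤ} (hij : i + 1 = j) {f : normCochains Y S i}
    (hf : f ∈ τ.cochains i) : d Y S hij f ∈ τ.cochains j := by
  rintro ⟨_ | n, h⟩ y
  · exact zero_mem _
  · rw [d_apply]
    exact sum_mem fun k _ => zsmul_mem
      (τ.val_map_le (SimplexCategory.δ k).op y (hf ⟨n, _⟩ (Y.δ k y))) _

lemma restrict_mem_cochains (g : X ⟶ Y) {f : normCochains Y S q} (hf : f ∈ τ.cochains q) :
    restrict g f ∈ (τ.comap g).cochains q :=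
  fun n x => hf n (g.app _ x)

/-- The complex of normalized cochains with coefficients in `τ` is acyclic. -/
def Acyclic (τ : CoeffSystem Y (AddSubgroup S)) : Prop :=
  ∀ (i j k : ℤ) (hij : i + 1 = j) (hjk : j + 1 = k), ∀ f ∈ τ.cochains j, d Y S hjk f = 0 →
    ∃ g ∈ τ.cochains i, d Y S hij g = f

/-- The quotient of the complex of cochains with coefficients in `τ₁` by the subcomplex of those
with coefficients in `τ₀` is acyclic. -/
def AcyclicQuotient (τ₀ τ₁ : CoeffSystem Y (AddSubgroup S)) : Prop :=
  ∀ (i j k : ℤ) (hij : i + 1 = j) (hjk : j + 1 = k), ∀ u ∈ τ₁.cochains j,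
    d Y S hjk u ∈ τ₀.cochains k → ∃ v ∈ τ₁.cochains i, u - d Y S hij v ∈ τ₀.cochains j

lemma Acyclic.quotient (h₀ : τ₀.Acyclic) (h₁ : τ₁.Acyclic) (h : τ₀ ≤ τ₁) :
    AcyclicQuotient τ₀ τ₁ := by
  intro i j k hij hjk u hu hdu
  obtain ⟨c, hc, hcu⟩ := h₀ j k (k + 1) hjk rfl _ hdu (d_d _ _ _)
  obtain ⟨v, hv, hvu⟩ := h₁ i j k hij hjk (u - c) (sub_mem hu (cochains_mono h hc))
    (by rw [map_sub, hcu, sub_self])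
  exact ⟨v, hv, by rwa [hvu, sub_sub_cancel]⟩

lemma Acyclic.of_comap_iso (e : X ≅ Y) (h : (τ.comap e.hom).Acyclic) : τ.Acyclic := by
  intro i j k hij hjk f hf hdf
  have he {n : SimplexCategoryᵒᵖ} (y : Y.obj n) : e.hom.app _ (e.inv.app _ y) = y := by simp
  obtain ⟨g, hg, hgf⟩ := h i j k hij hjk (restrict e.hom f) (restrict_mem_cochains _ hf)
    (by rw [← restrict_d, hdf]; exact map_zero (map e.hom (RingHom.id S) k))
  refine ⟨restrict e.inv g, fun n y => ?_, ?_⟩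
  · have hgy : g.1 n (e.inv.app _ y) ∈ τ.val (e.hom.app _ (e.inv.app _ y)) := hg n (e.inv.app _ y)
    rwa [he] at hgy
  · rw [← restrict_d, hgf]
    exact ext_apply fun n y => congrArg (f.1 n) (he y)

lemma exists_mem_cochains_sub_mem (h : ∀ {n : SimplexCategoryᵒᵖ} (y : Y.obj n),
    τ.val y ≤ τ₀.val y ⊔ τ₁.val y) {f : normCochains Y S q} (hf : f ∈ τ.cochains q) :
    ∃ g ∈ τ₁.cochains q, f - g ∈ τ₀.cochains q := by
  have hs (n) (y : Y _⦋n.1⦌) : ∃ s ∈ τ₁.val y, f.1 n y - s ∈ τ₀.val y ∧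
      (y ∈ Y.degenerate n.1 → s = 0) := by
    by_cases hy : y ∈ Y.degenerate n.1
    · exact ⟨0, zero_mem _, by simp [f.2 n y hy, zero_mem], fun _ => rfl⟩
    · obtain ⟨r, hr, s, hs, hrs⟩ := AddSubgroup.mem_sup.1 (h y (hf n y))
      exact ⟨s, hs, by rwa [← hrs, add_sub_cancel_right], fun h => (hy h).elim⟩
  choose s hs₁ hs₀ hs using hs
  exact ⟨⟨s, hs⟩, hs₁, hs₀⟩

end CoeffSystem

/-! ### Acyclicity for cylinders and horns -/

section

open MonoidalCategory CartesianMonoidalCategory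

/-- The morphism `Δ[1] ⊗ Δ[1] ⟶ Δ[1]` given by a monotone map on the vertices. -/
def squareMap (φ : Fin 2 × Fin 2 →o Fin 2) : (Δ[1] ⊗ Δ[1] : SSet.{0}) ⟶ Δ[1] where
  app _ := ↾fun s => SSet.stdSimplex.objMk
    (φ.comp ((SSet.stdSimplex.asOrderHom s.1).prod (SSet.stdSimplex.asOrderHom s.2)))
  naturality _ _ _ := rfl

/-- The vertices of `Δ[1]`, as subcomplexes. -/
abbrev endpoint (k : Fin 2) : (Δ[1] : SSet.{0}).Subcomplex := SSet.stdSimplex.face {k}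

/-- The ends of a cylinder. -/
abbrev cylinderEnd (X : SSet.{0}) (k : Fin 2) : (X ⊗ Δ[1] : SSet.{0}).Subcomplex :=
  (endpoint k).preimage (snd X Δ[1])

lemma mem_endpoint_iff {k : Fin 2} {n : ℕ} {s : (Δ[1] : SSet.{0}) _⦋n⦌} :
    s ∈ (endpoint k).obj _ ↔ ∀ i, s i = k := by
  simp only [SSet.stdSimplex.mem_face_iff, Finset.mem_singleton]

variable {X : SSet.{0}} {n : SimplexCategoryᵒᵖ}

lemma eq_of_mem_endpoint {k : Fin 2} {s t : (Δ[1] : SSet.{0}).obj n}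
    (hs : s ∈ (endpoint k).obj n) (ht : t ∈ (endpoint k).obj n) : s = t := by
  induction n using Opposite.rec with | _ n
  induction n using SimplexCategory.rec with | _ n
  ext i
  rw [mem_endpoint_iff.1 hs i, mem_endpoint_iff.1 ht i]

lemma ι₀_mem_cylinderEnd (x : X.obj n) :
    (SSet.ι₀ (X := X)).app n x ∈ (cylinderEnd X 0).obj n := by
  induction n using Opposite.rec with | _ n
  induction n using SimplexCategory.rec with | _ n
  exact mem_endpoint_iff.2 fun _ => rfl

lemma ι₁_mem_cylinderEnd (x : X.obj n) :
    (SSet.ι₁ (X := X)).app n x ∈ (cylinderEnd X 1).obj n := by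
  induction n using Opposite.rec with | _ n
  induction n using SimplexCategory.rec with | _ n
  exact mem_endpoint_iff.2 fun _ => rfl

lemma ι₀_app_fst_of_mem {y : (X ⊗ Δ[1] : SSet.{0}).obj n} (hy : y ∈ (cylinderEnd X 0).obj n) :
    (SSet.ι₀ (X := X)).app n y.1 = y :=
  Prod.ext rfl (eq_of_mem_endpoint (ι₀_mem_cylinderEnd y.1) hy)

lemma notMem_cylinderEnd_one {y : (X ⊗ Δ[1] : SSet.{0}).obj n} (h₀ : y ∈ (cylinderEnd X 0).obj n) :
    y ∉ (cylinderEnd X 1).obj n := by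
  intro h₁
  induction n using Opposite.rec with | _ n
  induction n using SimplexCategory.rec with | _ n
  exact zero_ne_one ((mem_endpoint_iff.1 h₀ 0).symm.trans (mem_endpoint_iff.1 h₁ 0))

/-- A homotopy from its underlying morphism: the condition relative to the empty subcomplex
is void. -/
def homotopyOfCylinder {Y : SSet.{0}} {f g : X ⟶ Y} (h : X ⊗ Δ[1] ⟶ Y) (h₀ : SSet.ι₀ ≫ h = f)
    (h₁ : SSet.ι₁ ≫ h = g) : SSet.Homotopy f g where
  h := h
  h₀ := h₀
  h₁ := h₁
  rel := by
    ext n y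
    exact (y.1.2 : False).elim

/-- The morphism `Δ[1] ⊗ Δ[1] ⟶ Δ[1]` given by the maximum on the vertices. -/
def maxMap : (Δ[1] ⊗ Δ[1] : SSet.{0}) ⟶ Δ[1] :=
  squareMap ⟨fun a => a.1 ⊔ a.2, fun _ _ h => sup_le_sup h.1 h.2⟩

/-- The contraction of a cylinder onto its end `1`. -/
def cylinderContraction (X : SSet.{0}) :
    SSet.Homotopy (𝟙 (X ⊗ Δ[1])) (fst X Δ[1] ≫ SSet.ι₁) :=
  homotopyOfCylinder ((α_ X Δ[1] Δ[1]).hom ≫ X ◁ maxMap)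
    (CartesianMonoidalCategory.hom_ext _ _ rfl (by
      ext n y
      induction n using Opposite.rec with | _ n
      induction n using SimplexCategory.rec with | _ n
      exact SSet.stdSimplex.ext _ _ fun i => max_eq_left (Fin.zero_le _)))
    (CartesianMonoidalCategory.hom_ext _ _ rfl (by
      ext n y
      induction n using Opposite.rec with | _ n
      induction n using SimplexCategory.rec with | _ n
      exact SSet.stdSimplex.ext _ _ fun i => max_eq_right (Fin.le_last _)))

lemma cylinderContraction_h_eq {m : ℕ} (k : Fin (m + 1)) (y : (X ⊗ Δ[1] : SSet.{0}) _⦋m⦌) :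
    (cylinderContraction X).toSimplicialObjectHomotopy.h k y =
      (X.σ k y.1, maxMap.app (op ⦋m + 1⦌)
        ((Δ[1] : SSet.{0}).σ k y.2, SSet.stdSimplex.objMk₁ k.succ.castSucc)) :=
  rfl

lemma cylinderContraction_h_mem {m : ℕ} (k : Fin (m + 1)) {y : (X ⊗ Δ[1] : SSet.{0}) _⦋m⦌}
    (hy : y ∈ (cylinderEnd X 1).obj _) :
    (cylinderContraction X).toSimplicialObjectHomotopy.h k y ∈ (cylinderEnd X 1).obj _ := by
  rw [cylinderContraction_h_eq]
  have hσ := mem_endpoint_iff.1 ((cylinderEnd X 1).map (SimplexCategory.σ k).op hy)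
  exact mem_endpoint_iff.2 fun i => (congrArg₂ max (hσ i) rfl).trans (max_eq_left (Fin.le_last _))

end

namespace CoeffSystem

open normCochains MonoidalCategory CartesianMonoidalCategory

section Cylinder

variable {X : SSet.{0}} {S : Type} [CommRing S] {q : ℤ} {σ σ₀ σ₁ : CoeffSystem X (AddSubgroup S)}

lemma acyclic_cylinder (σ : CoeffSystem X (AddSubgroup S)) :
    (rel (cylinderEnd X 1) (σ.comap (fst X Δ[1]))).Acyclic := by
  intro i j k hij hjk f hf hdf
  obtain ⟨hfσ, hf₁⟩ := mem_cochains_rel.1 hf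
  let H := (cylinderContraction X).toSimplicialObjectHomotopy
  have hend : restrict (fst X Δ[1] ≫ SSet.ι₁) f = 0 :=
    ext_apply fun n y => hf₁ n _ (ι₁_mem_cylinderEnd y.1)
  refine ⟨prism H hij f, mem_cochains_rel.2 ⟨fun n y => ?_, fun n y hy => ?_⟩, ?_⟩
  · exact neg_mem (sum_mem fun l _ => zsmul_mem
      (σ.val_map_le (SimplexCategory.σ l).op y.1 (hfσ ⟨n.1 + 1, _⟩ (H.h l y))) _)
  · exact neg_eq_zero.2 (Finset.sum_eq_zero fun l _ => (congrArg _
      (hf₁ ⟨n.1 + 1, _⟩ (H.h l y) (cylinderContraction_h_mem l hy))).trans (smul_zero _))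
  · have hd := restrict_eq_d_prism_add H hij hjk hdf
    rw [hend, add_zero] at hd
    exact hd.symm

/-- The coefficients on a cylinder which are `σ₀` at the end `0` and `σ₁` elsewhere
(for `σ₀ ≤ σ₁`). -/
def path (σ₀ σ₁ : CoeffSystem X (AddSubgroup S)) : CoeffSystem (X ⊗ Δ[1]) (AddSubgroup S) :=
  σ₁.comap (fst X Δ[1]) ⊓ on (cylinderEnd X 0) (σ₀.comap (fst X Δ[1]))

lemma mem_cochains_path {f : normCochains (X ⊗ Δ[1]) S q} :
    f ∈ (path σ₀ σ₁).cochains q ↔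
      f ∈ (σ₁.comap (fst X Δ[1])).cochains q ∧ restrict SSet.ι₀ f ∈ σ₀.cochains q := by
  refine mem_cochains_inf.trans (and_congr_right' (mem_cochains_on.trans ⟨fun h n x => ?_,
    fun h n y hy => ?_⟩))
  · exact h n _ (ι₀_mem_cylinderEnd x)
  · rw [← ι₀_app_fst_of_mem hy]
    exact h n y.1

lemma mem_cochains_rel_path {f : normCochains (X ⊗ Δ[1]) S q} :
    f ∈ (rel (cylinderEnd X 1) (path σ₀ σ₁)).cochains q ↔
      f ∈ (rel (cylinderEnd X 1) (σ₁.comap (fst X Δ[1]))).cochains q ∧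
        restrict SSet.ι₀ f ∈ σ₀.cochains q := by
  rw [mem_cochains_rel, mem_cochains_rel, mem_cochains_path, and_right_comm]

open Classical in
lemma exists_restrict_ι₀_eq {v : normCochains X S q} (hv : v ∈ σ.cochains q) :
    ∃ w ∈ (rel (cylinderEnd X 1) (σ.comap (fst X Δ[1]))).cochains q, restrict SSet.ι₀ w = v := by
  let w : normCochains (X ⊗ Δ[1]) S q :=
    ⟨fun n y => if y ∈ (cylinderEnd X 0).obj _ then v.1 n y.1 else 0, fun n y hy => by
      change (if _ then _ else _) = _
      rw [show v.1 n y.1 = 0 from (restrict (fst X Δ[1]) v).2 n y hy, ite_self]⟩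
  refine ⟨w, mem_cochains_rel.2 ⟨fun n y => ?_, fun n y hy => ?_⟩,
    ext_apply fun n x => if_pos (ι₀_mem_cylinderEnd x)⟩
  · change (if _ then _ else _) ∈ σ.val y.1
    split_ifs
    exacts [hv n y.1, zero_mem _]
  · exact if_neg fun h => notMem_cylinderEnd_one h hy

lemma acyclic_path (hq : AcyclicQuotient σ₀ σ₁) :
    (rel (cylinderEnd X 1) (path σ₀ σ₁)).Acyclic := by
  intro i j k hij hjk f hf hdf
  obtain ⟨hf₁, hf₀⟩ := mem_cochains_rel_path.1 hf
  obtain ⟨g, hg, rfl⟩ := acyclic_cylinder σ₁ i j k hij hjk f hf₁ hdf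
  have hi : i - 1 + 1 = i := by omega
  obtain ⟨v, hv, hgv⟩ := hq (i - 1) i j hi hij (restrict SSet.ι₀ g)
    (restrict_mem_cochains SSet.ι₀ (mem_cochains_rel.1 hg).1) (by rwa [← restrict_d])
  obtain ⟨w, hw, rfl⟩ := exists_restrict_ι₀_eq hv
  refine ⟨g - d _ S hi w, mem_cochains_rel_path.2 ⟨sub_mem hg (d_mem_cochains hi hw), ?_⟩,
    by rw [map_sub, d_d, sub_zero]⟩
  rwa [restrict_sub, restrict_d]

lemma acyclicQuotient_path {a b c : CoeffSystem X (AddSubgroup S)} (hbc : b ≤ c)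
    (hc : ∀ {n : SimplexCategoryᵒᵖ} (x : X.obj n), c.val x ≤ a.val x ⊔ b.val x) :
    AcyclicQuotient (rel (cylinderEnd X 1) (path (a ⊓ b) b))
      (rel (cylinderEnd X 1) (path a c)) := by
  intro i j k hij hjk u hu hdu
  obtain ⟨huc, hua⟩ := mem_cochains_rel_path.1 hu
  obtain ⟨w, hw, hwu⟩ := acyclic_cylinder b j k (k + 1) hjk rfl (d _ S hjk u)
    (mem_cochains_rel_path.1 hdu).1 (d_d _ _ _)
  have hbc' {q : ℤ} := cochains_rel_mono (q := q) (cylinderEnd X 1)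
    (show b.comap (fst X Δ[1]) ≤ c.comap (fst X Δ[1]) from fun y => hbc y.1)
  obtain ⟨g, hg, hgu⟩ := acyclic_cylinder c i j k hij hjk (u - w) (sub_mem huc (hbc' hw))
    (by rw [map_sub, hwu, sub_self])
  obtain ⟨s, hsb, hsa⟩ := exists_mem_cochains_sub_mem hc
    (restrict_mem_cochains SSet.ι₀ (mem_cochains_rel.1 hg).1)
  obtain ⟨v, hv, rfl⟩ := exists_restrict_ι₀_eq hsb
  have hgv : restrict SSet.ι₀ (g - v) ∈ a.cochains i := by rwa [restrict_sub]
  have huv : u - d _ S hij (g - v) = w + d _ S hij v := by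
    rw [map_sub, hgu]
    abel
  have hb : u - d _ S hij (g - v) ∈ (rel (cylinderEnd X 1) (b.comap (fst X Δ[1]))).cochains j := by
    rw [huv]
    exact add_mem hw (d_mem_cochains hij hv)
  refine ⟨g - v, mem_cochains_rel_path.2 ⟨sub_mem hg (hbc' hv), hgv⟩,
    mem_cochains_rel_path.2 ⟨hb, mem_cochains_inf.2 ⟨?_, ?_⟩⟩⟩
  · rw [restrict_sub, restrict_d]
    exact sub_mem hua (d_mem_cochains hij hgv)
  · exact restrict_mem_cochains SSet.ι₀ (mem_cochains_rel.1 hb).1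

end Cylinder

section Horn

variable {S : Type} [CommRing S] {n : ℕ} {i : Fin (n + 2)}

lemma stdSimplex_δ_id (k : Fin (n + 2)) :
    (Δ[n + 1] : SSet.{0}).δ k (SSet.stdSimplex.objEquiv.symm (𝟙 ⦋n + 1⦌)) =
      SSet.stdSimplex.objEquiv.symm (SimplexCategory.δ k) :=
  SSet.stdSimplex.objEquiv.injective (Category.comp_id (SimplexCategory.δ k))

lemma eq_zero_of_horn {q : ℤ} (hq : q ≠ n + 1) {f : normCochains Δ[n + 1] S q}
    (hf : ∀ m s, s ∈ (Λ[n + 1, i]).obj _ → f.1 m s = 0)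
    (hfi : ∀ h : (n : ℤ) = q,
      f.1 ⟨n, h⟩ (SSet.stdSimplex.objEquiv.symm (SimplexCategory.δ i)) = 0) : f = 0 := by
  refine ext_apply fun ⟨m, hm⟩ s => ?_
  by_cases hs : s ∈ (Δ[n + 1] : SSet.{0}).degenerate m
  · exact f.2 _ s hs
  rw [← SSet.mem_nonDegenerate_iff_notMem_degenerate,
    SSet.stdSimplex.mem_nonDegenerate_iff_mono] at hs
  have hle : m ≤ n + 1 := SimplexCategory.len_le_of_mono (SSet.stdSimplex.objEquiv s)
  obtain h | rfl : m < n ∨ m = n := by omega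
  · exact hf _ s (SSet.horn_obj_eq_univ i m ▸ Set.mem_univ _)
  · obtain ⟨j, hj⟩ := SimplexCategory.eq_δ_of_mono (SSet.stdSimplex.objEquiv s)
    obtain rfl := SSet.stdSimplex.objEquiv.eq_symm_apply.2 hj
    by_cases hij : j = i
    · exact hij ▸ hfi hm
    · exact hf _ _ ((SSet.objEquiv_symm_δ_mem_horn_iff j i).2 hij)

lemma d_apply_id_of_horn {f : normCochains Δ[n + 1] S n} {b : ℤ} (hb : (n : ℤ) + 1 = b)
    (hf : ∀ m s, s ∈ (Λ[n + 1, i]).obj _ → f.1 m s = 0) :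
    (d _ S hb f).1 ⟨n + 1, by omega⟩ (SSet.stdSimplex.objEquiv.symm (𝟙 ⦋n + 1⦌)) =
      (-1 : ℤ) ^ (i : ℕ) • f.1 ⟨n, rfl⟩ (SSet.stdSimplex.objEquiv.symm (SimplexCategory.δ i)) := by
  rw [d_apply, Finset.sum_eq_single i, stdSimplex_δ_id]
  · intro k _ hk
    rw [stdSimplex_δ_id, hf _ _ ((SSet.objEquiv_symm_δ_mem_horn_iff k i).2 hk), smul_zero]
  · simp

lemma eq_zero_of_horn_of_d_eq_zero {b c : ℤ} (hb : b ≠ n + 1) (hbc : b + 1 = c)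
    {f : normCochains Δ[n + 1] S b} (hf : ∀ m s, s ∈ (Λ[n + 1, i]).obj _ → f.1 m s = 0)
    (hdf : d _ S hbc f = 0) : f = 0 := by
  refine eq_zero_of_horn hb hf fun h => ?_
  subst h
  have hi := d_apply_id_of_horn hbc hf
  rw [hdf] at hi
  have hi' := congrArg ((-1 : ℤ) ^ (i : ℕ) • ·) hi.symm
  simpa only [smul_smul, ← mul_pow, neg_mul_neg, one_mul, one_pow, one_smul] using
    hi'.trans (smul_zero _)

open Classical in
lemma exists_d_eq_of_horn (i : Fin (n + 2)) {R : AddSubgroup S} {b : ℤ} (hb : (n : ℤ) + 1 = b)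
    {f : normCochains Δ[n + 1] S b} (hf : ∀ m s, f.1 m s ∈ R) :
    ∃ g ∈ (rel Λ[n + 1, i] (const Δ[n + 1] R)).cochains n, d _ S hb g = f := by
  let r : S := (-1 : ℤ) ^ (i : ℕ) •
    f.1 ⟨n + 1, by omega⟩ (SSet.stdSimplex.objEquiv.symm (𝟙 ⦋n + 1⦌))
  let g : normCochains Δ[n + 1] S n := ⟨fun m s =>
    if s ∈ (Δ[n + 1] : SSet.{0}).degenerate m.1 ∨ s ∈ (Λ[n + 1, i]).obj _ then 0 else r,
    fun m s hs => if_pos (.inl hs)⟩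
  have hg : ∀ m s, s ∈ (Λ[n + 1, i]).obj _ → g.1 m s = 0 := fun m s hs => if_pos (.inr hs)
  refine ⟨g, mem_cochains_rel.2 ⟨fun m s => ?_, hg⟩, ext_apply fun ⟨m, hm⟩ s => ?_⟩
  · change (if _ then _ else _) ∈ R
    split_ifs
    exacts [zero_mem _, zsmul_mem (K := R) (hf _ _) _]
  obtain rfl : m = n + 1 := by omega
  by_cases hs : s ∈ (Δ[n + 1] : SSet.{0}).degenerate (n + 1)
  · exact ((d _ S hb g).2 _ s hs).trans (f.2 _ s hs).symm
  rw [← SSet.mem_nonDegenerate_iff_notMem_degenerate, SSet.stdSimplex.nonDegenerate_top_dim] at hs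
  obtain rfl : s = SSet.stdSimplex.objEquiv.symm (𝟙 ⦋n + 1⦌) := hs
  have hgi : g.1 ⟨n, rfl⟩ (SSet.stdSimplex.objEquiv.symm (SimplexCategory.δ i)) = r := by
    refine if_neg (not_or.2 ⟨?_, fun h => (SSet.objEquiv_symm_δ_mem_horn_iff i i).1 h rfl⟩)
    rw [← SSet.mem_nonDegenerate_iff_notMem_degenerate,
      SSet.stdSimplex.objEquiv_symm_mem_nonDegenerate_iff_mono]
    infer_instance
  rw [d_apply_id_of_horn hb hg, hgi, smul_smul, ← mul_pow, neg_mul_neg, one_mul, one_pow, one_smul]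

lemma acyclic_horn (i : Fin (n + 2)) (R : AddSubgroup S) :
    (rel Λ[n + 1, i] (const Δ[n + 1] R)).Acyclic := by
  intro a b c hab hbc f hf hdf
  obtain ⟨hfR, hf₀⟩ := mem_cochains_rel.1 hf
  by_cases hb : b = n + 1
  · obtain rfl : a = n := by omega
    exact exists_d_eq_of_horn i hab hfR
  · exact ⟨0, zero_mem _, by rw [map_zero, eq_zero_of_horn_of_d_eq_zero hb hbc hf₀ hdf]⟩

end Horn

end CoeffSystem

/-! ### Algebras of cochains with coefficients in a system of subrings -/

lemma DGOperad.Alg.exists_lift_of_jointlyInjective {E : DGOperad} {A B : E.Alg} {J : Type*}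
    {C : J → E.Alg} (ι : ∀ j, B ⟶ C j)
    (hι : ∀ q (b b' : B.cplx.X q), (∀ j, ((ι j).hom.f q).hom b = ((ι j).hom.f q).hom b') → b = b')
    (φ : ∀ j, A ⟶ C j)
    (h : ∀ q a, ∃ b, ∀ j, ((ι j).hom.f q).hom b = ((φ j).hom.f q).hom a) :
    ∃ ψ : A ⟶ B, ∀ j, ψ ≫ ι j = φ j := by
  choose ψ hψ using h
  let Ψ (q : ℤ) : A.cplx.X q →ₗ[ℤ] B.cplx.X q := addMonoidHomToLinearMap
    (.mk' (ψ q) fun a b => hι q _ _ fun j => by rw [map_add, hψ, hψ, hψ, map_add])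
  have hΨ (q a j) : ((ι j).hom.f q).hom (Ψ q a) = ((φ j).hom.f q).hom a := hψ q a j
  have comm (i k : ℤ) (a : A.cplx.X i) :
      (B.cplx.d i k).hom (Ψ i a) = Ψ k ((A.cplx.d i k).hom a) := hι k _ _ fun j => calc
    ((ι j).hom.f k).hom ((B.cplx.d i k).hom (Ψ i a))
      = ((C j).cplx.d i k).hom (((ι j).hom.f i).hom (Ψ i a)) :=
        (ConcreteCategory.congr_hom ((ι j).hom.comm i k) (Ψ i a)).symm
    _ = ((C j).cplx.d i k).hom (((φ j).hom.f i).hom a) := congrArg _ (hΨ i a j)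
    _ = ((φ j).hom.f k).hom ((A.cplx.d i k).hom a) :=
        ConcreteCategory.congr_hom ((φ j).hom.comm i k) a
    _ = ((ι j).hom.f k).hom (Ψ k ((A.cplx.d i k).hom a)) := (hΨ k _ j).symm
  refine ⟨⟨⟨fun q => ModuleCat.ofHom (Ψ q), fun i k _ =>
    ModuleCat.hom_ext (LinearMap.ext (comm i k))⟩, fun p q r h x a => hι r _ _ fun j => ?_⟩,
    fun j => Alg.Hom.ext (HomologicalComplex.hom_ext _ _ fun q =>
      ModuleCat.hom_ext (LinearMap.ext fun a => hΨ q a j))⟩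
  refine (hΨ r _ j).trans ?_
  rw [(φ j).isAlgHom, (ι j).isAlgHom]
  exact congrArg _ (funext fun i => (hΨ _ _ j).symm)

lemma DGOperad.Alg.exists_factorization {E : DGOperad} {A B C : E.Alg} (ι : B ⟶ C)
    (hι : ∀ q, Function.Injective (ι.hom.f q).hom) (φ : A ⟶ C)
    (h : ∀ q a, ∃ b, (ι.hom.f q).hom b = (φ.hom.f q).hom a) : ∃ ψ : A ⟶ B, ψ ≫ ι = φ := by
  obtain ⟨ψ, hψ⟩ := exists_lift_of_jointlyInjective (fun _ : Unit => ι)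
    (fun q _ _ hb => hι q (hb ())) (fun _ => φ) fun q a => (h q a).imp fun _ hb _ => hb
  exact ⟨ψ, hψ ()⟩

/-- The underlying system of subgroups of a system of subrings. -/
def CoeffSystem.additive {Y : SSet.{0}} {S : Type} [CommRing S] (ρ : CoeffSystem Y (Subring S)) :
    CoeffSystem Y (AddSubgroup S) where
  val y := (ρ.val y).toAddSubgroup
  val_map_le f y := ρ.val_map_le f y

/-- The nondegenerate simplex of top dimension of a standard simplex. -/
def topSimplex (n : SimplexCategoryᵒᵖ) : (SSet.stdSimplex.{0}.obj n.unop).obj n :=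
  SSet.stdSimplex.objEquiv.symm (𝟙 _)

lemma yonedaEquiv_symm_app_topSimplex {X : SSet.{0}} {n : SimplexCategoryᵒᵖ} (x : X.obj n) :
    (SSet.yonedaEquiv.symm x : SSet.stdSimplex.obj n.unop ⟶ X).app n (topSimplex n) = x :=
  SSet.yonedaEquiv.apply_symm_apply x

namespace CochainAction

open normCochains

variable {E : DGOperad} (θ : CochainAction E) {A : E.Alg} {X Y : SSet.{0}} {R S : Type}
  [CommRing R] [CommRing S]

/-- The algebra `C^*(X; R)`. -/
abbrev C (X : SSet.{0}) (R : Type) [CommRing R] : E.Alg :=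
  (θ.cochainAlg.obj (CommRingCat.of R)).obj (op X)

/-- The functoriality of `C^*(X; R)` in both variables. -/
def cmap (g : X ⟶ Y) (φ : R →+* S) : θ.C Y R ⟶ θ.C X S :=
  ⟨cochainMap g φ, θ.natural g φ⟩

/-- Restriction of cochains as a morphism of algebras. -/
abbrev res (g : X ⟶ Y) : θ.C Y S ⟶ θ.C X S := θ.cmap g (RingHom.id S)

variable {θ}

/-- The cochain associated to an element of `A` by a morphism to an algebra of cochains. -/
def cochain (φ : A ⟶ θ.C Y S) (q : ℤ) (a : A.cplx.X q) : normCochains Y S q :=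
  (φ.hom.f q).hom a

lemma hom_ext {φ ψ : A ⟶ θ.C Y S}
    (h : ∀ q a n y, (cochain φ q a).1 n y = (cochain ψ q a).1 n y) : φ = ψ :=
  DGOperad.Alg.Hom.ext (HomologicalComplex.hom_ext _ _ fun q =>
    ModuleCat.hom_ext (LinearMap.ext fun a => ext_apply fun n y => h q a n y))

lemma cochain_comp_res (φ : A ⟶ θ.C Y S) (g : X ⟶ Y) (q : ℤ) (a : A.cplx.X q) (n)
    (x : X _⦋n.1⦌) :
    (cochain (φ ≫ θ.res g) q a).1 n x = (cochain φ q a).1 n (g.app _ x) :=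
  rfl

section

variable (θ) (ρ : CoeffSystem Y (Subring S))

/-- The cochains with coefficients in `ρ`, as a submodule of the algebra `C^*(Y; S)`. -/
def coeffSubmodule (q : ℤ) : Submodule ℤ ((θ.C Y S).cplx.X q) := ρ.additive.cochains q

lemma cochainAlg_d {i j : ℤ} (hij : i + 1 = j) :
    (θ.C Y S).cplx.d i j = ModuleCat.ofHom (normCochains.d Y S hij) :=
  dif_pos hij

lemma d_mem_coeffSubmodule (i j : ℤ) :
    ∀ f ∈ θ.coeffSubmodule ρ i, ((θ.C Y S).cplx.d i j).hom f ∈ θ.coeffSubmodule ρ j := by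
  intro f hf
  by_cases hij : i + 1 = j
  · rw [θ.cochainAlg_d hij]
    exact CoeffSystem.d_mem_cochains hij hf
  · rw [(θ.C Y S).cplx.shape i j hij]
    exact zero_mem _

/-- The value of an operation at a simplex `y` can be computed after restriction to `y`, where all
arguments have coefficients in the ring `ρ.val y`. -/
lemma act_mem_coeffSubmodule {n : ℕ} (p : ℤ) (q : Fin n → ℤ) (r : ℤ) (h : p + ∑ j, q j = r)
    (x : (E.obj n).X p) (a : ∀ j, (θ.C Y S).cplx.X (q j))
    (ha : ∀ j, a j ∈ θ.coeffSubmodule ρ (q j)) :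
    (θ.C Y S).str.act p q r h x a ∈ θ.coeffSubmodule ρ r := by
  intro m y
  let g : Δ[m.1] ⟶ Y := SSet.yonedaEquiv.symm y
  have hg {k} (s : (Δ[m.1] : SSet.{0}).obj k) : ρ.val (g.app _ s) ≤ ρ.val y :=
    ρ.val_map_le (SSet.stdSimplex.objEquiv s).op y
  let b (j : Fin n) : normCochains Δ[m.1] (ρ.val y) (q j) :=
    ⟨fun k s => ⟨(a j).1 k (g.app _ s), hg s (ha j k _)⟩, fun k s hs =>
      Subtype.ext ((a j).2 k _ (SSet.degenerate_app_apply hs g))⟩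
  have restrict_act : normCochains.map g (RingHom.id S) r ((θ.C Y S).str.act p q r h x a) =
      normCochains.map (𝟙 _) (ρ.val y).subtype r
        ((θ.C Δ[m.1] (ρ.val y)).str.act p q r h x b) :=
    ((θ.res (S := S) g).isAlgHom p q r h x a).trans
      (show _ = _ from ((θ.cmap (𝟙 Δ[m.1]) (ρ.val y).subtype).isAlgHom p q r h x b).symm)
  have act_top : ((θ.C Y S).str.act p q r h x a).1 m (g.app _ (topSimplex _)) ∈ ρ.val y :=
    Eq.subst (motive := (· ∈ ρ.val y))
      (congrFun (congrFun (congrArg Subtype.val restrict_act) m) (topSimplex _)).symm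
      (Subtype.property _)
  rwa [show g.app _ (topSimplex _) = y from yonedaEquiv_symm_app_topSimplex y] at act_top

/-- The algebra of cochains with coefficients in `ρ`. -/
def coeffAlg : E.Alg :=
  ⟨subCplx _ (θ.coeffSubmodule ρ) (θ.d_mem_coeffSubmodule ρ),
    (θ.C Y S).str.restrict _ (θ.act_mem_coeffSubmodule ρ)⟩

/-- The inclusion of the cochains with coefficients in `ρ`. -/
def coeffAlgι : θ.coeffAlg ρ ⟶ θ.C Y S :=
  ⟨subCplxι _ _ _, fun _ _ _ _ _ _ => rfl⟩

/-- Restriction of cochains with coefficients in `ρ`. -/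
def coeffRes (g : X ⟶ Y) : θ.coeffAlg ρ ⟶ θ.coeffAlg (ρ.comap g) where
  hom :=
    { f := fun q => ModuleCat.ofHom (addMonoidHomToLinearMap (.mk' (fun f =>
        (⟨((θ.res g).hom.f q).hom f.1, CoeffSystem.restrict_mem_cochains g f.2⟩ :
          θ.coeffSubmodule (ρ.comap g) q)) fun f f' => Subtype.ext (map_add _ f.1 f'.1)))
      comm' := fun i j _ => ModuleCat.hom_ext (LinearMap.ext fun f => Subtype.ext
        (ConcreteCategory.congr_hom ((θ.res g).hom.comm i j) f.1)) }
  isAlgHom p q r h x a := Subtype.ext ((θ.res g).isAlgHom p q r h x fun j => (a j).1)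

lemma coeffAlg_d_val {i j : ℤ} (hij : i + 1 = j) (f : (θ.coeffAlg ρ).cplx.X i) :
    (((θ.coeffAlg ρ).cplx.d i j).hom f).1 = normCochains.d Y S hij f.1 :=
  ConcreteCategory.congr_hom (θ.cochainAlg_d hij) f.1

open Classical in
lemma coeffRes_surjective (B : Y.Subcomplex) (q : ℤ) :
    Function.Surjective ((θ.coeffRes ρ B.ι).hom.f q).hom := by
  rintro ⟨(f : normCochains (B : SSet.{0}) S q), hf⟩
  let extend : normCochains Y S q :=
    ⟨fun n y => if h : y ∈ B.obj _ then f.1 n ⟨y, h⟩ else 0, fun n y hy => by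
      by_cases h : y ∈ B.obj _
      · exact (dif_pos h).trans
          (f.2 n ⟨y, h⟩ ((SSet.Subcomplex.mem_degenerate_iff _ ⟨y, h⟩).2 hy))
      · exact dif_neg h⟩
  have extend_mem : extend ∈ ρ.additive.cochains q := by
    intro n y
    change dite _ _ _ ∈ ρ.additive.val y
    split_ifs with h
    · exact hf n ⟨y, h⟩
    · exact zero_mem _
  exact ⟨⟨extend, extend_mem⟩, Subtype.ext (ext_apply fun n y => dif_pos y.2)⟩

lemma coeffRes_quasiIso (B : Y.Subcomplex) (h : (ρ.additive.rel B).Acyclic) :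
    QuasiIso (θ.coeffRes ρ B.ι).hom := by
  have ker (q : ℤ) (b : (θ.coeffAlg ρ).cplx.X q) :
      ((θ.coeffRes ρ B.ι).hom.f q).hom b = 0 ↔ b.1 ∈ (ρ.additive.rel B).cochains q := by
    refine Iff.trans ⟨fun hb => ⟨b.2, fun n y hy => ?_⟩, fun hb => ?_⟩
      CoeffSystem.mem_cochains_rel.symm
    · exact Subtype.ext (ext_apply fun n y => hb.2 n (B.ι.app _ y) y.2)
    · exact congrFun (congrFun (congrArg (fun c => c.1.1) hb) n) ⟨y, hy⟩
  refine quasiIso_of_surjective _ (θ.coeffRes_surjective ρ B) fun i j k hij hjk b hb hdb => ?_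
  obtain ⟨g, hg, hgb⟩ := h i j k hij hjk b.1 ((ker j b).1 hb)
    ((θ.coeffAlg_d_val ρ hjk b).symm.trans (congrArg Subtype.val hdb))
  exact ⟨⟨g, (CoeffSystem.mem_cochains_rel.1 hg).1⟩, (ker i _).2 hg,
    Subtype.ext ((θ.coeffAlg_d_val ρ hij _).trans hgb)⟩

end

/-- All cochains in the image of `φ` have coefficients in `ρ`. -/
def Valued (ρ : CoeffSystem Y (Subring S)) (φ : A ⟶ θ.C Y S) : Prop :=
  ∀ q a, cochain φ q a ∈ ρ.additive.cochains q

lemma Valued.res {ρ : CoeffSystem Y (Subring S)} {ρ' : CoeffSystem X (Subring S)}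
    {φ : A ⟶ θ.C Y S} (hφ : Valued ρ φ) (g : X ⟶ Y) (h : ρ.comap g ≤ ρ') :
    Valued ρ' (φ ≫ θ.res g) :=
  fun q a n x => h x (hφ q a n (g.app _ x))

lemma Valued.exists_factorization {ρ : CoeffSystem Y (Subring S)} {φ : A ⟶ θ.C Y S}
    (hφ : Valued ρ φ) : ∃ ψ : A ⟶ θ.coeffAlg ρ, ψ ≫ θ.coeffAlgι ρ = φ :=
  DGOperad.Alg.exists_factorization (θ.coeffAlgι ρ) (fun _ => Subtype.val_injective) φ
    fun q a => ⟨⟨_, hφ q a⟩, rfl⟩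

lemma Valued.exists_extension (hA : A.IsCofibrant) (ρ : CoeffSystem Y (Subring S))
    (B : Y.Subcomplex) (hB : (ρ.additive.rel B).Acyclic) {φ : A ⟶ θ.C (B : SSet.{0}) S}
    (hφ : Valued (ρ.comap B.ι) φ) : ∃ Φ : A ⟶ θ.C Y S, Valued ρ Φ ∧ Φ ≫ θ.res B.ι = φ := by
  obtain ⟨ψ, rfl⟩ := hφ.exists_factorization
  obtain ⟨Ψ, rfl⟩ := hA _ _ (θ.coeffRes ρ B.ι) (θ.coeffRes_surjective ρ B)
    (θ.coeffRes_quasiIso ρ B hB) ψ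
  exact ⟨Ψ ≫ θ.coeffAlgι ρ, fun q a => ((Ψ.hom.f q).hom a).2, rfl⟩

/-! ### Gluing of morphisms to algebras of cochains -/

variable (θ A Y S) in
/-- A morphism from `A` to the cochains on a simplicial set over `Y`. It is thought of as a morphism
to the cochains on `Y` which is only defined on the image of `f`. -/
structure PartialHom where
  src : SSet.{0}
  f : src ⟶ Y
  φ : A ⟶ θ.C src S

namespace PartialHom

/-- The values of two partial morphisms agree over each simplex of `Y`. -/
def Agree (u v : PartialHom θ A Y S) : Prop :=
  ∀ q a n z z', u.f.app _ z = v.f.app _ z' → (cochain u.φ q a).1 n z = (cochain v.φ q a).1 n z'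

instance : Std.Symm (Agree (θ := θ) (A := A) (Y := Y) (S := S)) :=
  ⟨fun _ _ h q a n z z' hz => (h q a n z' z hz.symm).symm⟩

lemma agree_self (u : PartialHom θ A Y S) [Mono u.f] : u.Agree u := by
  intro q a n z z' hz
  rw [(mono_iff_injective _).1 (inferInstance : Mono (u.f.app _)) hz]

lemma agree_of_comp_res_eq {u v : PartialHom θ A Y S} {F : SSet.{0}} (f : F ⟶ u.src) (g : F ⟶ v.src)
    (hF : ∀ n z z', u.f.app n z = v.f.app n z' → ∃ w, f.app n w = z ∧ g.app n w = z')
    (h : u.φ ≫ θ.res f = v.φ ≫ θ.res g) : u.Agree v := by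
  intro q a n z z' hz
  obtain ⟨w, rfl, rfl⟩ := hF _ z z' hz
  exact congrArg (fun φ => (cochain φ q a).1 n w) h

variable (s : Set (PartialHom θ A Y S))

lemma exists_glued_cochain (hs : ∀ n (y : Y.obj n), ∃ u ∈ s, y ∈ Set.range (u.f.app n))
    (h : ∀ u ∈ s, ∀ v ∈ s, u.Agree v) (q : ℤ) (a : A.cplx.X q) :
    ∃ c : normCochains Y S q, ∀ u ∈ s, restrict u.f c = cochain u.φ q a := by
  choose u hu z hz using hs
  refine ⟨⟨fun n y => (cochain (u _ y).φ q a).1 n (z _ y), ?_⟩, fun v hv => ext_apply fun n x =>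
    h _ (hu _ _) v hv q a n _ _ (hz _ _)⟩
  rintro n _ ⟨m, hm, g, y, rfl⟩
  have hy : (u _ y).f.app _ ((u _ y).src.map g.op (z _ y)) = Y.map g.op y := by
    rw [NatTrans.naturality_apply, hz]
  refine (h _ (hu _ _) _ (hu _ y) q a n _ _ ((hz _ _).trans hy.symm)).trans ?_
  exact (cochain _ q a).2 n _ ⟨m, hm, g, _, rfl⟩

lemma exists_glue (hs : ∀ n (y : Y.obj n), ∃ u ∈ s, y ∈ Set.range (u.f.app n))
    (h : ∀ u ∈ s, ∀ v ∈ s, u.Agree v) : ∃ Φ : A ⟶ θ.C Y S, ∀ u ∈ s, Φ ≫ θ.res u.f = u.φ := by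
  have ext_of_restrict (q : ℤ) (b b' : normCochains Y S q)
      (hb : ∀ u : s, restrict u.1.f b = restrict u.1.f b') : b = b' := by
    refine ext_apply fun n y => ?_
    obtain ⟨u, hu, z, rfl⟩ := hs _ y
    exact congrFun (congrFun (congrArg Subtype.val (hb ⟨u, hu⟩)) n) z
  obtain ⟨Φ, hΦ⟩ := DGOperad.Alg.exists_lift_of_jointlyInjective
    (fun u : s => θ.res (S := S) u.1.f) ext_of_restrict (fun u => u.1.φ) fun q a =>
      let ⟨c, hc⟩ := exists_glued_cochain s hs h q a
      ⟨c, fun u => hc u.1 u.2⟩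
  exact ⟨Φ, fun u hu => hΦ ⟨u, hu⟩⟩

lemma exists_extension (hA : A.IsCofibrant) (ρ : CoeffSystem Y (Subring S))
    (hρ : ∀ u ∈ s, Valued (ρ.comap u.f) u.φ) (h : ∀ u ∈ s, ∀ v ∈ s, u.Agree v)
    (B : Y.Subcomplex) (hB : ∀ n (y : Y.obj n), y ∈ B.obj n ↔ ∃ u ∈ s, y ∈ Set.range (u.f.app n))
    (hac : (ρ.additive.rel B).Acyclic) :
    ∃ Φ : A ⟶ θ.C Y S, Valued ρ Φ ∧ ∀ u ∈ s, Φ ≫ θ.res u.f = u.φ := by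
  have range_le (u) (hu : u ∈ s) : SSet.Subcomplex.range u.f ≤ B :=
    fun n y hy => (hB n y).2 ⟨u, hu, hy⟩
  let onB (u : s) : PartialHom θ A B S :=
    ⟨u.1.src, SSet.Subcomplex.lift u.1.f (range_le u.1 u.2), u.1.φ⟩
  obtain ⟨φ, hφ⟩ := exists_glue (Set.range onB)
    (by
      rintro n ⟨y, hy⟩
      obtain ⟨u, hu, z, rfl⟩ := (hB n y).1 hy
      exact ⟨_, ⟨⟨u, hu⟩, rfl⟩, z, rfl⟩)
    (by
      rintro _ ⟨u, rfl⟩ _ ⟨v, rfl⟩ q a n z z' hz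
      exact h u.1 u.2 v.1 v.2 q a n z z' (congrArg Subtype.val hz))
  have valued_φ : Valued (ρ.comap B.ι) φ := by
    rintro q a n ⟨y, hy⟩
    obtain ⟨u, hu, z, rfl⟩ := (hB _ y).1 hy
    have hz := hρ u hu q a n z
    rwa [show u.φ = _ from (hφ _ ⟨⟨u, hu⟩, rfl⟩).symm] at hz
  obtain ⟨Φ, hΦ, rfl⟩ := valued_φ.exists_extension hA ρ B hac
  exact ⟨Φ, hΦ, fun u hu => hφ _ ⟨⟨u, hu⟩, rfl⟩⟩

end PartialHom

end CochainAction

/-! ### Mapping spaces -/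

section

open MonoidalCategory CartesianMonoidalCategory

variable {C : Type*} [Category* C] [CartesianMonoidalCategory C]

lemma mono_whiskerRight {X Y : C} (f : X ⟶ Y) [Mono f] (Z : C) : Mono (f ▷ Z) where
  right_cancellation a b h := by
    refine CartesianMonoidalCategory.hom_ext _ _ ?_ ?_
    · simpa [cancel_mono_assoc_iff] using congrArg (· ≫ fst Y Z) h
    · simpa using congrArg (· ≫ snd Y Z) h

lemma mono_whiskerLeft (Z : C) {X Y : C} (f : X ⟶ Y) [Mono f] : Mono (Z ◁ f) where
  right_cancellation a b h := by
    refine CartesianMonoidalCategory.hom_ext _ _ ?_ ?_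
    · simpa using congrArg (· ≫ fst Z Y) h
    · simpa [cancel_mono_assoc_iff] using congrArg (· ≫ snd Z Y) h

end

namespace CochainAction

open normCochains MonoidalCategory CartesianMonoidalCategory

variable {E : DGOperad} {θ : CochainAction E} {A : E.Alg} {S : Type} [CommRing S]

variable (θ A) in
/-- The simplicial set of morphisms from `A` to the algebras of cochains on `Δ[n] ⊗ K` with
coefficients which are pulled back from `K`. -/
def mapping (K : SSet.{0}) (ρ : CoeffSystem K (Subring S)) : SSet.{0} where
  obj n := {φ : A ⟶ θ.C (SSet.stdSimplex.obj n.unop ⊗ K) S // Valued (ρ.comap (snd _ _)) φ}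
  map f := ↾fun φ => ⟨φ.1 ≫ θ.res (SSet.stdSimplex.map f.unop ▷ K), φ.2.res _ fun _ => le_rfl⟩
  map_id n := by
    ext φ
    have : SSet.stdSimplex.map (𝟙 n.unop) ▷ K = 𝟙 _ :=
      (congrArg (· ▷ K) (SSet.stdSimplex.map_id _)).trans (id_whiskerRight _ _)
    exact congrArg (fun g => φ.1 ≫ θ.res g) this
  map_comp f g := by
    ext φ
    have : SSet.stdSimplex.map (g.unop ≫ f.unop) ▷ K =
      SSet.stdSimplex.map g.unop ▷ K ≫ SSet.stdSimplex.map f.unop ▷ K :=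
      (congrArg (· ▷ K) (SSet.stdSimplex.map_comp _ _)).trans (comp_whiskerRight _ _ _)
    exact congrArg (fun g => φ.1 ≫ θ.res g) this

variable {K L : SSet.{0}} {ρ : CoeffSystem K (Subring S)} {ρ' : CoeffSystem L (Subring S)}

lemma mapping_ext {n : SimplexCategoryᵒᵖ} {φ ψ : (θ.mapping A K ρ).obj n}
    (h : ∀ q a m y, (cochain φ.1 q a).1 m y = (cochain ψ.1 q a).1 m y) : φ = ψ :=
  Subtype.ext (hom_ext h)

/-- The functoriality of mapping spaces. -/
def mappingMap (g : L ⟶ K) (h : ρ.comap g ≤ ρ') : θ.mapping A K ρ ⟶ θ.mapping A L ρ' where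
  app _ := ↾fun φ => ⟨φ.1 ≫ θ.res (_ ◁ g), φ.2.res _ fun y => h y.2⟩
  naturality _ _ _ := rfl

variable {X X' : SSet.{0}}

/-- The morphism to a mapping space given by a morphism to an algebra of cochains. -/
def curry (ψ : A ⟶ θ.C (X ⊗ K) S) (hψ : Valued (ρ.comap (snd X K)) ψ) :
    X ⟶ θ.mapping A K ρ where
  app n := ↾fun x => ⟨ψ ≫ θ.res (SSet.yonedaEquiv.symm x ▷ K), hψ.res _ fun _ => le_rfl⟩
  naturality n m f := by
    ext x
    refine mapping_ext fun q a l y => congrArg ((cochain ψ q a).1 l) (Prod.ext ?_ rfl)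
    exact ConcreteCategory.congr_hom (NatTrans.congr_app
      (SSet.yonedaEquiv_symm_naturality_left f.unop x).symm _) y.1

lemma cochain_app_eq (u : X ⟶ θ.mapping A K ρ) {n : SimplexCategoryᵒᵖ} (x : X.obj n) (q : ℤ)
    (a : A.cplx.X q) (m) (y : (SSet.stdSimplex.obj n.unop ⊗ K) _⦋m.1⦌) :
    (cochain (u.app n x).1 q a).1 m y = (cochain (u.app (op ⦋m.1⦌)
      ((SSet.yonedaEquiv.symm x : SSet.stdSimplex.obj n.unop ⟶ X).app _ y.1)).1 q a).1 m
        (topSimplex _, y.2) := by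
  obtain ⟨s, k⟩ := y
  obtain ⟨f, rfl⟩ := SSet.stdSimplex.objEquiv.symm.surjective s
  have hu : u.app _ (X.map f.op x) = (θ.mapping A K ρ).map f.op (u.app _ x) :=
    NatTrans.naturality_apply u f.op x
  rw [show (SSet.yonedaEquiv.symm x : SSet.stdSimplex.obj n.unop ⟶ X).app (op ⦋m.1⦌)
    (SSet.stdSimplex.objEquiv.symm f) = X.map f.op x from rfl, hu]
  refine congrArg ((cochain (u.app n x).1 q a).1 m) (Prod.ext ?_ rfl)
  exact SSet.stdSimplex.objEquiv.injective (Category.id_comp f).symm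

lemma exists_uncurry (u : X ⟶ θ.mapping A K ρ) : ∃ ψ : A ⟶ θ.C (X ⊗ K) S,
    ∀ q a m (y : (X ⊗ K) _⦋m.1⦌), (cochain ψ q a).1 m y =
      (cochain (u.app _ y.1).1 q a).1 m (topSimplex _, y.2) := by
  let atSimplex (x : Σ n, X.obj n) : PartialHom θ A (X ⊗ K) S :=
    ⟨SSet.stdSimplex.obj x.1.unop ⊗ K, SSet.yonedaEquiv.symm x.2 ▷ K, (u.app x.1 x.2).1⟩
  have agree (x x') : (atSimplex x).Agree (atSimplex x') := by
    intro q a n z z' hz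
    have h₁ : (SSet.yonedaEquiv.symm x.2 : SSet.stdSimplex.obj x.1.unop ⟶ X).app _ z.1 =
        (SSet.yonedaEquiv.symm x'.2 : SSet.stdSimplex.obj x'.1.unop ⟶ X).app _ z'.1 :=
      congrArg Prod.fst hz
    have h₂ : z.2 = z'.2 := congrArg Prod.snd hz
    refine (cochain_app_eq u x.2 q a n z).trans (Eq.trans ?_ (cochain_app_eq u x'.2 q a n z').symm)
    rw [h₁, h₂]
  obtain ⟨ψ, hψ⟩ := PartialHom.exists_glue (Set.range atSimplex)
    (fun n y => ⟨_, ⟨⟨n, y.1⟩, rfl⟩, (topSimplex n, y.2),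
      Prod.ext (yonedaEquiv_symm_app_topSimplex y.1) rfl⟩)
    (Set.forall_mem_range.2 fun x => Set.forall_mem_range.2 (agree x))
  refine ⟨ψ, fun q a m y => ?_⟩
  rw [← show ψ ≫ _ = (u.app _ y.1).1 from hψ _ ⟨⟨op ⦋m.1⦌, y.1⟩, rfl⟩]
  exact congrArg ((cochain ψ q a).1 m) (Prod.ext (yonedaEquiv_symm_app_topSimplex y.1).symm rfl)

/-- The morphism to an algebra of cochains given by a morphism to a mapping space. -/
def uncurry (u : X ⟶ θ.mapping A K ρ) : A ⟶ θ.C (X ⊗ K) S := (exists_uncurry u).choose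

lemma cochain_uncurry (u : X ⟶ θ.mapping A K ρ) (q a m) (y : (X ⊗ K) _⦋m.1⦌) :
    (cochain (uncurry u) q a).1 m y =
      (cochain (u.app _ y.1).1 q a).1 m (topSimplex _, y.2) :=
  (exists_uncurry u).choose_spec q a m y

lemma valued_uncurry (u : X ⟶ θ.mapping A K ρ) : Valued (ρ.comap (snd X K)) (uncurry u) := by
  intro q a m y
  rw [cochain_uncurry]
  exact (u.app _ y.1).2 q a m (topSimplex _, y.2)

lemma uncurry_injective {u v : X ⟶ θ.mapping A K ρ} (h : uncurry u = uncurry v) : u = v := by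
  ext n x
  refine mapping_ext fun q a m y => ?_
  refine (cochain_app_eq u x q a m y).trans (Eq.trans ?_ (cochain_app_eq v x q a m y).symm)
  refine (cochain_uncurry u q a m (_, y.2)).symm.trans ?_
  rw [h]
  exact cochain_uncurry v q a m (_, y.2)

lemma uncurry_curry (ψ : A ⟶ θ.C (X ⊗ K) S) (hψ : Valued (ρ.comap (snd X K)) ψ) :
    uncurry (curry ψ hψ) = ψ := by
  refine hom_ext fun q a m y => ?_
  rw [cochain_uncurry]
  exact congrArg ((cochain ψ q a).1 m) (Prod.ext (yonedaEquiv_symm_app_topSimplex y.1) rfl)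

lemma uncurry_comp (i : X' ⟶ X) (u : X ⟶ θ.mapping A K ρ) :
    uncurry (i ≫ u) = uncurry u ≫ θ.res (i ▷ K) := by
  refine hom_ext fun q a m y => ?_
  rw [cochain_uncurry, cochain_comp_res, cochain_uncurry]
  rfl

lemma uncurry_comp_mappingMap (g : L ⟶ K) (h : ρ.comap g ≤ ρ') (u : X ⟶ θ.mapping A K ρ) :
    uncurry (u ≫ mappingMap g h) = uncurry u ≫ θ.res (X ◁ g) := by
  refine hom_ext fun q a m y => ?_
  rw [cochain_uncurry, cochain_comp_res, cochain_uncurry]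
  rfl

namespace PartialHom

/-- The partial morphism to the cochains on `X ⊗ K` given by a morphism from a simplicial set over
`X` to a mapping space. -/
def whiskerRight (i : X' ⟶ X) (u : X' ⟶ θ.mapping A K ρ) : PartialHom θ A (X ⊗ K) S :=
  ⟨X' ⊗ K, i ▷ K, uncurry u⟩

/-- The partial morphism to the cochains on `X ⊗ K` given by a morphism from `X` to the mapping
space of a simplicial set over `K`. -/
def whiskerLeft (g : L ⟶ K) (v : X ⟶ θ.mapping A L ρ') : PartialHom θ A (X ⊗ K) S :=
  ⟨X ⊗ L, X ◁ g, uncurry v⟩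

lemma agree_whiskerRight_whiskerLeft {i : X' ⟶ X} {u : X' ⟶ θ.mapping A K ρ} {g : L ⟶ K}
    {v : X ⟶ θ.mapping A L ρ'} (hg : ρ.comap g ≤ ρ') (h : u ≫ mappingMap g hg = i ≫ v) :
    (whiskerRight i u).Agree (whiskerLeft g v) := by
  refine agree_of_comp_res_eq (F := X' ⊗ L) (X' ◁ g) (i ▷ L) (fun n z z' hz => ?_) ?_
  · have h₁ : i.app n z.1 = z'.1 := congrArg Prod.fst hz
    have h₂ : z.2 = g.app n z'.2 := congrArg Prod.snd hz
    exact ⟨(z.1, z'.2), Prod.ext rfl h₂.symm, Prod.ext h₁ rfl⟩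
  · exact (uncurry_comp_mappingMap g hg u).symm.trans
      ((congrArg uncurry h).trans (uncurry_comp i v))

lemma agree_whiskerLeft {L' F : SSet.{0}} {ρ₁ : CoeffSystem L' (Subring S)}
    {ρF : CoeffSystem F (Subring S)} {g : L ⟶ K} {g' : L' ⟶ K} {v : X ⟶ θ.mapping A L ρ'}
    {v' : X ⟶ θ.mapping A L' ρ₁} (f : F ⟶ L) (f' : F ⟶ L')
    (hF : ∀ n l l', g.app n l = g'.app n l' → ∃ w, f.app n w = l ∧ f'.app n w = l')
    (hf : ρ'.comap f ≤ ρF) (hf' : ρ₁.comap f' ≤ ρF)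
    (h : v ≫ mappingMap f hf = v' ≫ mappingMap f' hf') :
    (whiskerLeft g v).Agree (whiskerLeft g' v') := by
  refine agree_of_comp_res_eq (F := X ⊗ F) (X ◁ f) (X ◁ f') (fun n z z' hz => ?_) ?_
  · have h₁ : z.1 = z'.1 := congrArg Prod.fst hz
    obtain ⟨w, hw, hw'⟩ := hF n z.2 z'.2 (congrArg Prod.snd hz)
    exact ⟨(z.1, w), Prod.ext rfl hw, Prod.ext h₁ hw'⟩
  · exact (uncurry_comp_mappingMap f hf v).symm.trans
      ((congrArg uncurry h).trans (uncurry_comp_mappingMap f' hf' v'))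

lemma valued_whiskerRight (i : X' ⟶ X) (u : X' ⟶ θ.mapping A K ρ) :
    Valued ((ρ.comap (snd X K)).comap (whiskerRight i u).f) (whiskerRight i u).φ :=
  valued_uncurry u

lemma valued_whiskerLeft (g : L ⟶ K) (hg : ρ' ≤ ρ.comap g) (v : X ⟶ θ.mapping A L ρ') :
    Valued ((ρ.comap (snd X K)).comap (whiskerLeft g v).f) (whiskerLeft g v).φ :=
  fun q a n y => hg y.2 (valued_uncurry v q a n y)

lemma mem_range_whiskerRight_f {i : X' ⟶ X} {u : X' ⟶ θ.mapping A K ρ} {n : SimplexCategoryᵒᵖ}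
    {y : (X ⊗ K).obj n} :
    y ∈ Set.range ((whiskerRight i u).f.app n) ↔ y.1 ∈ Set.range (i.app n) :=
  ⟨fun ⟨z, hz⟩ => ⟨z.1, congrArg Prod.fst hz⟩, fun ⟨x, hx⟩ => ⟨(x, y.2), Prod.ext hx rfl⟩⟩

lemma mem_range_whiskerLeft_f {g : L ⟶ K} {v : X ⟶ θ.mapping A L ρ'} {n : SimplexCategoryᵒᵖ}
    {y : (X ⊗ K).obj n} :
    y ∈ Set.range ((whiskerLeft g v).f.app n) ↔ y.2 ∈ Set.range (g.app n) :=
  ⟨fun ⟨z, hz⟩ => ⟨z.2, congrArg Prod.snd hz⟩, fun ⟨l, hl⟩ => ⟨(y.1, l), Prod.ext rfl hl⟩⟩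

lemma mono_whiskerRight_f (i : X' ⟶ X) [Mono i] (u : X' ⟶ θ.mapping A K ρ) :
    Mono (whiskerRight i u).f :=
  mono_whiskerRight i K

lemma mono_whiskerLeft_f (g : L ⟶ K) [Mono g] (v : X ⟶ θ.mapping A L ρ') :
    Mono (whiskerLeft g v).f :=
  mono_whiskerLeft X g

lemma comp_eq_of_res_whiskerRight {w : X ⟶ θ.mapping A K ρ} {i : X' ⟶ X}
    {u : X' ⟶ θ.mapping A K ρ}
    (h : uncurry w ≫ θ.res (whiskerRight i u).f = (whiskerRight i u).φ) : i ≫ w = u :=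
  uncurry_injective ((uncurry_comp i w).trans h)

lemma comp_mappingMap_eq_of_res_whiskerLeft {w : X ⟶ θ.mapping A K ρ} {g : L ⟶ K}
    (hg : ρ.comap g ≤ ρ') {v : X ⟶ θ.mapping A L ρ'}
    (h : uncurry w ≫ θ.res (whiskerLeft g v).f = (whiskerLeft g v).φ) : w ≫ mappingMap g hg = v :=
  uncurry_injective ((uncurry_comp_mappingMap g hg w).trans h)

lemma exists_mapping_extension (s : Set (PartialHom θ A (X ⊗ K) S)) (hA : A.IsCofibrant)
    (hmono : ∀ u ∈ s, Mono u.f) (hs : s.Pairwise Agree)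
    (hρ : ∀ u ∈ s, Valued ((ρ.comap (snd X K)).comap u.f) u.φ) (B : (X ⊗ K).Subcomplex)
    (hB : ∀ n (y : (X ⊗ K).obj n), y ∈ B.obj n ↔ ∃ u ∈ s, y ∈ Set.range (u.f.app n))
    (hac : ((ρ.comap (snd X K)).additive.rel B).Acyclic) :
    ∃ w : X ⟶ θ.mapping A K ρ, ∀ u ∈ s, uncurry w ≫ θ.res u.f = u.φ := by
  have hagree (u) (hu : u ∈ s) (v) (hv : v ∈ s) : u.Agree v := by
    obtain rfl | huv := eq_or_ne u v
    · have := hmono u hu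
      exact u.agree_self
    · exact hs hu hv huv
  obtain ⟨Φ, hΦ, h⟩ := exists_extension s hA _ hρ hagree B hB hac
  refine ⟨curry Φ hΦ, fun u hu => ?_⟩
  rw [uncurry_curry]
  exact h u hu

end PartialHom

end CochainAction

/-! ### Weak equivalences -/

section

open MonoidalCategory CartesianMonoidalCategory

/-- The constant homotopy. -/
def homotopyRefl {X Y : SSet.{0}} (f : X ⟶ Y) : SSet.Homotopy f f :=
  homotopyOfCylinder (fst X Δ[1] ≫ f) rfl rfl

lemma HomotopyClasses.precomp_precomp {X Y K : SSet.{0}} {f : X ⟶ Y} {g : Y ⟶ X}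
    (h : SSet.Homotopy (f ≫ g) (𝟙 X)) (c : HomotopyClasses X K) :
    precomp f K (precomp g K c) = c := by
  obtain ⟨v, rfl⟩ := Quot.exists_rep c
  refine Quot.sound ⟨homotopyOfCylinder (h.h ≫ v) ?_ ?_⟩
  · rw [← Category.assoc, h.h₀, Category.assoc]
  · rw [← Category.assoc, h.h₁, Category.id_comp]

lemma isWeakEquivalence_of_homotopy {X Y : SSet.{0}} {f : X ⟶ Y} {g : Y ⟶ X}
    (h₁ : SSet.Homotopy (f ≫ g) (𝟙 X)) (h₂ : SSet.Homotopy (g ≫ f) (𝟙 Y)) :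
    IsWeakEquivalence f := fun K _ =>
  Function.bijective_iff_has_inverse.2 ⟨HomotopyClasses.precomp g K,
    HomotopyClasses.precomp_precomp h₂, HomotopyClasses.precomp_precomp h₁⟩

lemma IsWeakEquivalence.comp {X Y Z : SSet.{0}} {f : X ⟶ Y} {g : Y ⟶ Z}
    (hf : IsWeakEquivalence f) (hg : IsWeakEquivalence g) : IsWeakEquivalence (f ≫ g) := by
  intro K _
  convert (hf K).comp (hg K) using 1
  funext c
  obtain ⟨v, rfl⟩ := Quot.exists_rep c
  exact congrArg (Quot.mk _) (Category.assoc f g v)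

open Classical in
/-- The morphism on the ends of a cylinder which is `f` at the end `0` and `g` at the end `1`. -/
def cylinderEndsDesc {W Z : SSet.{0}} (f g : W ⟶ Z) :
    ((cylinderEnd W 0 ⊔ cylinderEnd W 1 : (W ⊗ Δ[1] : SSet.{0}).Subcomplex) : SSet.{0}) ⟶ Z where
  app n := ↾fun y => if y.1 ∈ (cylinderEnd W 0).obj n then f.app n y.1.1 else g.app n y.1.1
  naturality n m a := by
    ext y
    obtain ⟨y, hy⟩ := y
    by_cases h : y ∈ (cylinderEnd W 0).obj n
    · refine (if_pos ((cylinderEnd W 0).map a h)).trans ?_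
      refine Eq.trans ?_ (congrArg (Z.map a) (if_pos h)).symm
      exact NatTrans.naturality_apply f a y.1
    · have h₁ : y ∈ (cylinderEnd W 1).obj n := hy.resolve_left h
      refine (if_neg fun h₀ => notMem_cylinderEnd_one h₀ ((cylinderEnd W 1).map a h₁)).trans ?_
      refine Eq.trans ?_ (congrArg (Z.map a) (if_neg h)).symm
      exact NatTrans.naturality_apply g a y.1

lemma isWeakEquivalence_of_hasLiftingProperty {W P : SSet.{0}} (π : W ⟶ P)
    (h : ∀ {X' X : SSet.{0}} (i : X' ⟶ X) [Mono i], HasLiftingProperty i π) :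
    IsWeakEquivalence π := by
  have := h (⊥ : P.Subcomplex).ι
  have sq₁ : CommSq (SSet.Subcomplex.isInitialBot.to W) (⊥ : P.Subcomplex).ι π (𝟙 P) :=
    ⟨SSet.Subcomplex.isInitialBot.hom_ext _ _⟩
  let s := sq₁.lift
  have hs : s ≫ π = 𝟙 P := sq₁.fac_right
  let B : (W ⊗ Δ[1] : SSet.{0}).Subcomplex := cylinderEnd W 0 ⊔ cylinderEnd W 1
  have := h B.ι
  have sq₂ : CommSq (cylinderEndsDesc (π ≫ s) (𝟙 W)) B.ι π (fst W Δ[1] ≫ π) := ⟨by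
    ext n ⟨y, hy⟩
    by_cases h : y ∈ (cylinderEnd W 0).obj n
    · refine (congrArg (π.app n) (if_pos h)).trans ?_
      exact ConcreteCategory.congr_hom (NatTrans.congr_app hs n) (π.app n y.1)
    · exact congrArg (π.app n) (if_neg h)⟩
  refine isWeakEquivalence_of_homotopy (g := s) (homotopyOfCylinder sq₂.lift ?_ ?_)
    (hs ▸ homotopyRefl _)
  · ext n x
    have hx := ι₀_mem_cylinderEnd x
    refine (ConcreteCategory.congr_hom (NatTrans.congr_app sq₂.fac_left n)
      ⟨SSet.ι₀.app n x, .inl hx⟩).trans ?_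
    exact if_pos hx
  · ext n x
    have hx := ι₁_mem_cylinderEnd x
    refine (ConcreteCategory.congr_hom (NatTrans.congr_app sq₂.fac_left n)
      ⟨SSet.ι₁.app n x, .inr hx⟩).trans ?_
    exact if_neg fun h₀ => notMem_cylinderEnd_one h₀ hx

end

namespace CochainAction

open normCochains MonoidalCategory CartesianMonoidalCategory

variable {E : DGOperad} {θ : CochainAction E} {A : E.Alg} {S : Type} [CommRing S]
  {K : SSet.{0}} {ρ : CoeffSystem K (Subring S)} {R : Type} [CommRing R]

/-- The morphism from `T(A; R)` to a mapping space with coefficients which contain the image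
of `R`. -/
def toMapping (φ : R →+* S) (h : .const K φ.range ≤ ρ) :
    (θ.T A).obj (CommRingCat.of R) ⟶ θ.mapping A K ρ where
  app n := ↾fun (ψ : A ⟶ θ.C (SSet.stdSimplex.obj n.unop) R) =>
    ⟨ψ ≫ θ.cmap (fst _ K) φ, fun _ _ _ y => h y.2 ⟨_, rfl⟩⟩
  naturality _ _ _ := rfl

lemma cmap_injective {φ : R →+* S} (hφ : Function.Injective φ) (X : SSet.{0}) (q : ℤ) :
    Function.Injective ((θ.cmap (𝟙 X) φ).hom.f q).hom := fun _ _ hfg =>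
  ext_apply fun n x => hφ (congrFun (congrFun (congrArg Subtype.val hfg) n) x)

lemma comp_cmap_injective {φ : R →+* S} (hφ : Function.Injective φ) {X : SSet.{0}}
    {ψ ψ' : A ⟶ θ.C X R} (h : ψ ≫ θ.cmap (𝟙 X) φ = ψ' ≫ θ.cmap (𝟙 X) φ) : ψ = ψ' :=
  hom_ext fun q a n x => hφ (congrArg (fun w => (cochain w q a).1 n x) h)

lemma exists_comp_cmap_eq {φ : R →+* S} (hφ : Function.Injective φ) (k₀ : K _⦋0⦌)
    (hk₀ : ρ.comap (SSet.const k₀ : K ⟶ K) ≤ .const K φ.range)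
    {n : SimplexCategoryᵒᵖ} (u : (θ.mapping A K ρ).obj n) :
    ∃ ψ : A ⟶ θ.C (SSet.stdSimplex.obj n.unop) R,
      ψ ≫ θ.cmap (𝟙 _) φ = u.1 ≫ θ.res (lift (𝟙 _) (SSet.const k₀)) := by
  refine DGOperad.Alg.exists_factorization _ (cmap_injective hφ _) _ fun q a => ?_
  have mem_range (m) (x : (SSet.stdSimplex.obj n.unop : SSet.{0}) _⦋m.1⦌) :
      (cochain (u.1 ≫ θ.res (lift (𝟙 _) (SSet.const k₀))) q a).1 m x ∈ φ.range :=
    hk₀ (K.map (SimplexCategory.const _ _ 0).op k₀) (u.2 q a m ((lift (𝟙 _) (SSet.const k₀) :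
      SSet.stdSimplex.obj n.unop ⟶ SSet.stdSimplex.obj n.unop ⊗ K).app _ x))
  choose f hf using mem_range
  exact ⟨⟨f, fun m x hx => hφ (((hf m x).trans
    ((cochain _ q a).2 m x hx)).trans (map_zero φ).symm)⟩, ext_apply hf⟩

/-- The retraction of a mapping space to `T(A; R)` given by evaluation at a vertex. -/
def ofMapping {φ : R →+* S} (hφ : Function.Injective φ) (k₀ : K _⦋0⦌)
    (hk₀ : ρ.comap (SSet.const k₀ : K ⟶ K) ≤ .const K φ.range) :
    θ.mapping A K ρ ⟶ (θ.T A).obj (CommRingCat.of R) where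
  app n := ↾fun u => (exists_comp_cmap_eq hφ k₀ hk₀ u).choose
  naturality n m f := by
    ext u
    refine comp_cmap_injective hφ ?_
    refine (exists_comp_cmap_eq hφ k₀ hk₀ ((θ.mapping A K ρ).map f u)).choose_spec.trans ?_
    exact (congrArg (· ≫ θ.res (SSet.stdSimplex.map f.unop))
      (exists_comp_cmap_eq hφ k₀ hk₀ u).choose_spec).symm

lemma ofMapping_app_comp_cmap {φ : R →+* S} (hφ : Function.Injective φ) (k₀ : K _⦋0⦌)
    (hk₀ : ρ.comap (SSet.const k₀ : K ⟶ K) ≤ .const K φ.range) {n : SimplexCategoryᵒᵖ}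
    (u : (θ.mapping A K ρ).obj n) :
    ((ofMapping hφ k₀ hk₀).app n u : A ⟶ θ.C (SSet.stdSimplex.obj n.unop) R) ≫ θ.cmap (𝟙 _) φ =
      u.1 ≫ θ.res (lift (𝟙 _) (SSet.const k₀)) :=
  (exists_comp_cmap_eq hφ k₀ hk₀ u).choose_spec

/-- The homotopy on a mapping space given by a homotopy on its source. -/
def mappingHomotopy (H : K ⊗ Δ[1] ⟶ K)
    (hH : ρ.comap H ≤ ρ.comap (fst K Δ[1])) :
    θ.mapping A K ρ ⊗ Δ[1] ⟶ θ.mapping A K ρ where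
  app n := ↾fun w => ⟨w.1.1 ≫ θ.res (lift (fst _ _) (lift (snd _ _) (fst _ _ ≫
    (SSet.yonedaEquiv.symm w.2 : SSet.stdSimplex.obj n.unop ⟶ Δ[1])) ≫ H)),
    w.1.2.res _ fun y => hH _⟩
  naturality n m f := by
    ext w
    refine mapping_ext fun q a l y => congrArg ((cochain w.1.1 q a).1 l) (Prod.ext rfl ?_)
    refine congrArg (H.app _) (Prod.ext rfl ?_)
    exact ConcreteCategory.congr_hom (NatTrans.congr_app
      (SSet.yonedaEquiv_symm_naturality_left f.unop w.2).symm _) y.1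

lemma isWeakEquivalence_toMapping {φ : R →+* S} (hφ : Function.Injective φ) (k₀ : K _⦋0⦌)
    (hk₀ : ρ.comap (SSet.const k₀ : K ⟶ K) ≤ .const K φ.range)
    (H : SSet.Homotopy (SSet.const k₀) (𝟙 K)) (hH : ρ.comap H.h ≤ ρ.comap (fst K Δ[1]))
    (h : .const K φ.range ≤ ρ) : IsWeakEquivalence (toMapping (θ := θ) (A := A) φ h) := by
  have retract : toMapping (θ := θ) (A := A) φ h ≫ ofMapping hφ k₀ hk₀ = 𝟙 _ := by
    ext n ψ
    exact comp_cmap_injective hφ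
      (ofMapping_app_comp_cmap hφ k₀ hk₀ ((toMapping (θ := θ) (A := A) φ h).app n ψ))
  refine isWeakEquivalence_of_homotopy (g := ofMapping hφ k₀ hk₀) (retract ▸ homotopyRefl _)
    (homotopyOfCylinder (mappingHomotopy H.h hH) ?_ ?_)
  · ext n u
    refine mapping_ext fun q a l y => ?_
    have h₁ := congrArg (fun w => (cochain w q a).1 l y.1) (ofMapping_app_comp_cmap hφ k₀ hk₀ u)
    refine Eq.trans ?_ h₁.symm
    refine congrArg ((cochain u.1 q a).1 l) (Prod.ext rfl ?_)
    exact ConcreteCategory.congr_hom (NatTrans.congr_app H.h₀ _) y.2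
  · ext n u
    refine mapping_ext fun q a l y => ?_
    refine congrArg ((cochain u.1 q a).1 l) (Prod.ext rfl ?_)
    exact ConcreteCategory.congr_hom (NatTrans.congr_app H.h₁ _) y.2

end CochainAction

/-! ### Fibrations between mapping spaces -/

section

open MonoidalCategory CartesianMonoidalCategory

variable {X : SSet.{0}} {n : SimplexCategoryᵒᵖ}

lemma mem_range_ι_app_iff {B : X.Subcomplex} {x : X.obj n} :
    x ∈ Set.range (B.ι.app n) ↔ x ∈ B.obj n :=
  Set.ext_iff.1 Subtype.range_val x

/-- The constant morphism to a vertex of `Δ[1]`. -/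
abbrev vertex (X : SSet.{0}) (k : Fin 2) : X ⟶ Δ[1] :=
  SSet.const (SSet.stdSimplex.obj₀Equiv.symm k)

lemma vertex_mem_endpoint (k : Fin 2) (x : X.obj n) :
    (vertex X k).app n x ∈ (endpoint k).obj n := by
  induction n using Opposite.rec with | _ n
  induction n using SimplexCategory.rec with | _ n
  exact mem_endpoint_iff.2 fun _ => rfl

lemma vertex_app_eq {Y : SSet.{0}} (k : Fin 2) (x : X.obj n) (y : Y.obj n) :
    (vertex X k).app n x = (vertex Y k).app n y :=
  eq_of_mem_endpoint (vertex_mem_endpoint k x) (vertex_mem_endpoint k y)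

lemma vertex_one_notMem_endpoint_zero (x : X.obj n) :
    (vertex X 1).app n x ∉ (endpoint 0).obj n :=
  fun h => notMem_cylinderEnd_one (y := (x, (vertex X 1).app n x)) h (vertex_mem_endpoint 1 x)

lemma mem_range_vertex_app_iff {k : Fin 2} {s : (Δ[1] : SSet.{0}).obj n} :
    s ∈ Set.range ((vertex Δ[0] k).app n) ↔ s ∈ (endpoint k).obj n := by
  refine ⟨?_, fun h => ⟨(SSet.stdSimplex.isTerminalObj₀.from Δ[1]).app n s,
    eq_of_mem_endpoint (vertex_mem_endpoint k _) h⟩⟩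
  rintro ⟨l, rfl⟩
  exact vertex_mem_endpoint k l

instance (k : Fin 2) : Mono (vertex Δ[0] k) := SSet.stdSimplex.isTerminalObj₀.mono_from _

/-- The projection from the product with a point. -/
def prodPointIso (X : SSet.{0}) : X ⊗ Δ[0] ≅ X where
  hom := fst X Δ[0]
  inv := lift (𝟙 X) (SSet.stdSimplex.isTerminalObj₀.from X)
  hom_inv_id := CartesianMonoidalCategory.hom_ext _ _ rfl
    (SSet.stdSimplex.isTerminalObj₀.hom_ext _ _)
  inv_hom_id := rfl

/-- The simplices of `X ⊗ Δ[1] ⊗ Δ[1]` which lie over `B`, or have a coordinate equal to the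
vertex `1`. -/
def squareBoundary (B : X.Subcomplex) : (X ⊗ Δ[1] ⊗ Δ[1] : SSet.{0}).Subcomplex :=
  B.preimage (fst X (Δ[1] ⊗ Δ[1])) ⊔ (endpoint 1).preimage (snd X _ ≫ fst Δ[1] Δ[1]) ⊔
    (endpoint 1).preimage (snd X _ ≫ snd Δ[1] Δ[1])

lemma mem_squareBoundary {B : X.Subcomplex} {y : (X ⊗ Δ[1] ⊗ Δ[1] : SSet.{0}).obj n} :
    y ∈ (squareBoundary B).obj n ↔
      y.1 ∈ B.obj n ∨ y.2.1 ∈ (endpoint 1).obj n ∨ y.2.2 ∈ (endpoint 1).obj n :=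
  or_assoc

end

namespace CoeffSystem

open MonoidalCategory CartesianMonoidalCategory

section

variable {Y : SSet.{0}} {S : Type} [CommRing S] {τ τ' : CoeffSystem Y (AddSubgroup S)}
  {n : SimplexCategoryᵒᵖ} {y : Y.obj n} {s : S}

lemma Acyclic.of_mem_val_iff (hτ : τ.Acyclic)
    (h : ∀ {n : SimplexCategoryᵒᵖ} (y : Y.obj n) (s : S), s ∈ τ'.val y ↔ s ∈ τ.val y) :
    τ'.Acyclic := by
  have heq (q : ℤ) : τ'.cochains q = τ.cochains q :=
    Submodule.ext fun f => forall₂_congr fun _ y => h y _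
  intro i j k hij hjk f hf hdf
  rw [heq] at hf ⊢
  exact hτ i j k hij hjk f hf hdf

lemma mem_val_rel {B : Y.Subcomplex} :
    s ∈ (rel B τ).val y ↔ s ∈ τ.val y ∧ (y ∈ B.obj n → s = 0) :=
  and_congr_right' AddSubgroup.mem_iInf

lemma mem_val_path {X : SSet.{0}} {σ₀ σ₁ : CoeffSystem X (AddSubgroup S)}
    {y : (X ⊗ Δ[1] : SSet.{0}).obj n} :
    s ∈ (path σ₀ σ₁).val y ↔
      s ∈ σ₁.val y.1 ∧ (y ∈ (cylinderEnd X 0).obj n → s ∈ σ₀.val y.1) :=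
  and_congr_right' AddSubgroup.mem_iInf

end

variable {S : Type} [CommRing S]

/-- The system of subrings on `Δ[1]` which is `R` at the vertex `0` and everything elsewhere. -/
def interval (R : Subring S) : CoeffSystem Δ[1] (Subring S) :=
  on (endpoint 0) (const Δ[1] R)

/-- The system of subrings on `Δ[1] ⊗ Δ[1]` which is the intersection of the systems `interval P`
and `interval Q` on the two factors. -/
def square (P Q : Subring S) : CoeffSystem (Δ[1] ⊗ Δ[1]) (Subring S) :=
  (interval P).comap (fst Δ[1] Δ[1]) ⊓ (interval Q).comap (snd Δ[1] Δ[1])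

variable {R P Q : Subring S} {X : SSet.{0}} {n : SimplexCategoryᵒᵖ} {s : S}

lemma mem_val_interval {t : (Δ[1] : SSet.{0}).obj n} :
    s ∈ (interval R).val t ↔ (t ∈ (endpoint 0).obj n → s ∈ R) :=
  Subring.mem_iInf

lemma le_comap_interval_vertex_one (ρ : CoeffSystem X (Subring S)) :
    ρ ≤ (interval R).comap (vertex X 1) :=
  fun x _ _ => mem_val_interval.2 fun h => (vertex_one_notMem_endpoint_zero x h).elim

lemma mem_val_square {y : (Δ[1] ⊗ Δ[1] : SSet.{0}).obj n} :
    s ∈ (square P Q).val y ↔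
      (y.1 ∈ (endpoint 0).obj n → s ∈ P) ∧ (y.2 ∈ (endpoint 0).obj n → s ∈ Q) :=
  and_congr mem_val_interval mem_val_interval

lemma acyclic_horn_prod_point {n : ℕ} (i : Fin (n + 2)) (R : Subring S) :
    (rel (Λ[n + 1, i].preimage (fst _ Δ[0]))
      ((const Δ[0] R).comap (snd Δ[n + 1] Δ[0])).additive).Acyclic :=
  .of_comap_iso (prodPointIso _).symm (acyclic_horn i R.toAddSubgroup)

lemma acyclic_horn_interval {n : ℕ} (i : Fin (n + 2)) (R : Subring S) :
    (rel (Λ[n + 1, i].preimage (fst _ Δ[1]) ⊔ cylinderEnd _ 1)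
      ((interval R).comap (snd Δ[n + 1] Δ[1])).additive).Acyclic := by
  have quotient : AcyclicQuotient (rel Λ[n + 1, i] (const Δ[n + 1] R.toAddSubgroup))
      (rel Λ[n + 1, i] (const Δ[n + 1] (⊤ : AddSubgroup S))) :=
    (acyclic_horn i _).quotient (acyclic_horn i _) fun _ => inf_le_inf_right _ le_top
  refine (acyclic_path quotient).of_mem_val_iff fun {m} y s => ?_
  have hR : s ∈ ((interval R).comap (snd Δ[n + 1] Δ[1])).additive.val y ↔
      (y ∈ (cylinderEnd _ 0).obj m → s ∈ R) := mem_val_interval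
  have hB : y ∈ (Λ[n + 1, i].preimage (fst _ Δ[1]) ⊔ cylinderEnd _ 1).obj m ↔
    y.1 ∈ Λ[n + 1, i].obj m ∨ y ∈ (cylinderEnd _ 1).obj m := Iff.rfl
  have htop : s ∈ (const Δ[n + 1] (⊤ : AddSubgroup S)).val y.1 := AddSubgroup.mem_top s
  have hconst : s ∈ (const Δ[n + 1] R.toAddSubgroup).val y.1 ↔ s ∈ R := Iff.rfl
  rw [mem_val_rel, mem_val_rel, mem_val_path, mem_val_rel, mem_val_rel, hR, hB, hconst]
  grind

lemma rel_const_le_sup {G H : AddSubgroup S} (hGH : G ⊔ H = ⊤) (B : X.Subcomplex) (x : X.obj n) :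
    (rel B (const X (⊤ : AddSubgroup S))).val x ≤
      (rel B (const X G)).val x ⊔ (rel B (const X H)).val x := by
  intro s hs
  by_cases hx : x ∈ B.obj n
  · rw [(mem_val_rel.1 hs).2 hx]
    exact zero_mem _
  · obtain ⟨g, hg, h, hh, rfl⟩ := AddSubgroup.mem_sup.1 (hGH ▸ AddSubgroup.mem_top s)
    exact add_mem (AddSubgroup.mem_sup_left (mem_val_rel.2 ⟨hg, fun hx' => (hx hx').elim⟩))
      (AddSubgroup.mem_sup_right (mem_val_rel.2 ⟨hh, fun hx' => (hx hx').elim⟩))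

lemma acyclic_square (hPQ : P.toAddSubgroup ⊔ Q.toAddSubgroup = ⊤) (B : X.Subcomplex) :
    (rel (squareBoundary B) ((square P Q).comap (snd X _)).additive).Acyclic := by
  have quotient := acyclicQuotient_path (b := rel B (const X Q.toAddSubgroup))
    (c := rel B (const X (⊤ : AddSubgroup S))) (fun _ => inf_le_inf_right _ le_top)
    (rel_const_le_sup hPQ B)
  refine .of_comap_iso (α_ X Δ[1] Δ[1]) ((acyclic_path quotient).of_mem_val_iff fun {m} y s => ?_)
  have hsquare : s ∈ (rel (squareBoundary B) ((square P Q).comap (snd X _)).additive).val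
      ((α_ X Δ[1] Δ[1]).hom.app m y) ↔
      ((y.1 ∈ (cylinderEnd X 0).obj m → s ∈ P) ∧ (y ∈ (cylinderEnd _ 0).obj m → s ∈ Q)) ∧
        (y.1.1 ∈ B.obj m ∨ y.1 ∈ (cylinderEnd X 1).obj m ∨ y ∈ (cylinderEnd _ 1).obj m → s = 0) :=
    mem_val_rel.trans (and_congr mem_val_square (imp_congr_left mem_squareBoundary))
  have hinf {τ τ' : CoeffSystem X (AddSubgroup S)} :
      s ∈ (τ ⊓ τ').val y.1.1 ↔ s ∈ τ.val y.1.1 ∧ s ∈ τ'.val y.1.1 := Iff.rfl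
  have hconst (G : AddSubgroup S) : s ∈ (const X G).val y.1.1 ↔ s ∈ G := Iff.rfl
  refine hsquare.trans ?_
  simp only [mem_val_rel, mem_val_path, hinf, hconst, Subring.mem_toAddSubgroup,
    AddSubgroup.mem_top, true_and]
  grind

end CoeffSystem

namespace CochainAction

open MonoidalCategory CartesianMonoidalCategory PartialHom CoeffSystem

variable {E : DGOperad} {θ : CochainAction E} {A : E.Alg} {S : Type} [CommRing S]

lemma kanComplex_mapping (hA : A.IsCofibrant) (R : Subring S) :
    SSet.KanComplex (θ.mapping A Δ[0] (.const Δ[0] R)) := by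
  refine (isFibrant_iff _).2 ⟨?_⟩
  rw [fibrations_eq]
  intro _ _ _ hf
  simp only [J, MorphismProperty.iSup_iff] at hf
  obtain ⟨n, ⟨i⟩⟩ := hf
  refine ⟨fun {t _} _ => ?_⟩
  let s : Set (PartialHom θ A (Δ[n + 1] ⊗ Δ[0]) S) := {whiskerRight Λ[n + 1, i].ι t}
  have hB (m) (y : (Δ[n + 1] ⊗ Δ[0] : SSet.{0}).obj m) :
      y ∈ (Λ[n + 1, i].preimage (fst _ Δ[0])).obj m ↔ ∃ u ∈ s, y ∈ Set.range (u.f.app m) := by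
    simp only [s, Set.mem_singleton_iff, exists_eq_left, mem_range_whiskerRight_f,
      mem_range_ι_app_iff]
    rfl
  obtain ⟨w, hw⟩ := exists_mapping_extension s hA (by rintro _ rfl; exact mono_whiskerRight_f _ t)
    (Set.pairwise_singleton _ _) (by rintro _ rfl; exact valued_whiskerRight _ t) _ hB
    (acyclic_horn_prod_point i R)
  exact ⟨⟨⟨w, comp_eq_of_res_whiskerRight (hw _ rfl), terminal.hom_ext _ _⟩⟩⟩

/-- Evaluation at the end `1` of paths with coefficients `R` at the end `0`. -/
def evalOne (R : Subring S) :
    θ.mapping A Δ[1] (.interval R) ⟶ θ.mapping A Δ[0] (.const Δ[0] (⊤ : Subring S)) :=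
  mappingMap (vertex Δ[0] 1) fun _ => le_top

lemma fibration_evalOne (hA : A.IsCofibrant) (R : Subring S) :
    Fibration (evalOne R : θ.mapping A Δ[1] _ ⟶ _) := by
  rw [SSet.modelCategoryQuillen.fibration_iff]
  intro _ _ _ hf
  simp only [J, MorphismProperty.iSup_iff] at hf
  obtain ⟨n, ⟨i⟩⟩ := hf
  refine ⟨fun {t v} sq => ?_⟩
  let onHorn := whiskerRight Λ[n + 1, i].ι t
  let onEnd : PartialHom θ A (Δ[n + 1] ⊗ Δ[1]) S := whiskerLeft (vertex Δ[0] 1) v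
  have hB (m) (y : (Δ[n + 1] ⊗ Δ[1] : SSet.{0}).obj m) :
      y ∈ (Λ[n + 1, i].preimage (fst _ Δ[1]) ⊔ cylinderEnd _ 1).obj m ↔
        ∃ u ∈ ({onHorn, onEnd} : Set _), y ∈ Set.range (u.f.app m) := by
    simp only [onHorn, onEnd, Set.mem_insert_iff, Set.mem_singleton_iff, exists_eq_or_imp,
      exists_eq_left, mem_range_whiskerRight_f, mem_range_whiskerLeft_f, mem_range_ι_app_iff,
      mem_range_vertex_app_iff]
    rfl
  obtain ⟨w, hw⟩ := exists_mapping_extension {onHorn, onEnd} hA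
    (by rintro _ (rfl | rfl); exacts [mono_whiskerRight_f _ t, mono_whiskerLeft_f _ v])
    (Set.pairwise_pair_of_symm.2 fun _ => agree_whiskerRight_whiskerLeft (fun _ => le_top) sq.w)
    (by
      rintro _ (rfl | rfl)
      exacts [valued_whiskerRight _ t,
        valued_whiskerLeft _ (le_comap_interval_vertex_one _) v])
    _ hB (acyclic_horn_interval i R)
  exact ⟨⟨⟨w, comp_eq_of_res_whiskerRight (hw onHorn (.inl rfl)),
    comp_mappingMap_eq_of_res_whiskerLeft (fun _ => le_top) (hw onEnd (.inr rfl))⟩⟩⟩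

variable (P Q : Subring S)

/-- Restriction to the simplices whose second coordinate is `1`. -/
def squareFst : θ.mapping A (Δ[1] ⊗ Δ[1]) (.square P Q) ⟶ θ.mapping A Δ[1] (.interval P) :=
  mappingMap (lift (𝟙 _) (vertex Δ[1] 1)) fun _ => inf_le_left

/-- Restriction to the simplices whose first coordinate is `1`. -/
def squareSnd : θ.mapping A (Δ[1] ⊗ Δ[1]) (.square P Q) ⟶ θ.mapping A Δ[1] (.interval Q) :=
  mappingMap (lift (vertex Δ[1] 1) (𝟙 _)) fun _ => inf_le_right

lemma squareFst_evalOne :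
    (squareFst P Q : θ.mapping A _ _ ⟶ _) ≫ evalOne P = squareSnd P Q ≫ evalOne Q := by
  ext n u
  exact mapping_ext fun q a m y => congrArg ((cochain u.1 q a).1 m)
    (Prod.ext rfl
    (Prod.ext (vertex_app_eq 1 y.2 ((vertex Δ[0] 1).app _ y.2))
      (vertex_app_eq 1 ((vertex Δ[0] 1).app _ y.2) y.2)))

/-- The morphism from the mapping space of the square to the pullback of the mapping spaces of
its two sides which meet in the vertex `(1, 1)`. -/
def squareToPullback : θ.mapping A (Δ[1] ⊗ Δ[1]) (.square P Q) ⟶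
    pullback (evalOne P : θ.mapping A _ _ ⟶ _) (evalOne Q) :=
  pullback.lift (squareFst P Q) (squareSnd P Q) (squareFst_evalOne P Q)

variable {P Q}

lemma mem_range_fstSide_iff {n : SimplexCategoryᵒᵖ} {y : (Δ[1] ⊗ Δ[1] : SSet.{0}).obj n} :
    y ∈ Set.range ((lift (𝟙 _) (vertex Δ[1] 1)).app n) ↔ y.2 ∈ (endpoint 1).obj n := by
  refine ⟨?_, fun h => ⟨y.1, Prod.ext rfl (eq_of_mem_endpoint (vertex_mem_endpoint 1 y.1) h)⟩⟩
  rintro ⟨l, rfl⟩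
  exact vertex_mem_endpoint 1 l

lemma mem_range_sndSide_iff {n : SimplexCategoryᵒᵖ} {y : (Δ[1] ⊗ Δ[1] : SSet.{0}).obj n} :
    y ∈ Set.range ((lift (vertex Δ[1] 1) (𝟙 _)).app n) ↔ y.1 ∈ (endpoint 1).obj n := by
  refine ⟨?_, fun h => ⟨y.2, Prod.ext (eq_of_mem_endpoint (vertex_mem_endpoint 1 y.2) h) rfl⟩⟩
  rintro ⟨l, rfl⟩
  exact vertex_mem_endpoint 1 l

lemma agree_sides {X : SSet.{0}} {v₁ : X ⟶ θ.mapping A Δ[1] (.interval P)}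
    {v₂ : X ⟶ θ.mapping A Δ[1] (.interval Q)} (h : v₁ ≫ evalOne P = v₂ ≫ evalOne Q) :
    (whiskerLeft (lift (𝟙 _) (vertex Δ[1] 1)) v₁).Agree
      (whiskerLeft (lift (vertex Δ[1] 1) (𝟙 _)) v₂) := by
  refine agree_whiskerLeft (vertex Δ[0] 1) (vertex Δ[0] 1) (fun n l l' hl => ?_)
    (fun _ => le_top) (fun _ => le_top) h
  have h₁ : l = (vertex Δ[1] 1).app n l' := congrArg Prod.fst hl
  have h₂ : (vertex Δ[1] 1).app n l = l' := congrArg Prod.snd hl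
  exact ⟨(SSet.stdSimplex.isTerminalObj₀.from Δ[1]).app n l,
    (vertex_app_eq 1 _ _).trans h₁.symm, (vertex_app_eq 1 _ _).trans h₂⟩

lemma exists_square_extension (hA : A.IsCofibrant) (hPQ : P.toAddSubgroup ⊔ Q.toAddSubgroup = ⊤)
    {X' X : SSet.{0}} (i : X' ⟶ X) [Mono i] {t : X' ⟶ θ.mapping A (Δ[1] ⊗ Δ[1]) (.square P Q)}
    {v₁ : X ⟶ θ.mapping A Δ[1] (.interval P)} {v₂ : X ⟶ θ.mapping A Δ[1] (.interval Q)}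
    (h₁ : t ≫ squareFst P Q = i ≫ v₁) (h₂ : t ≫ squareSnd P Q = i ≫ v₂)
    (h₁₂ : v₁ ≫ evalOne P = v₂ ≫ evalOne Q) :
    ∃ w : X ⟶ θ.mapping A (Δ[1] ⊗ Δ[1]) (.square P Q),
      i ≫ w = t ∧ w ≫ squareFst P Q = v₁ ∧ w ≫ squareSnd P Q = v₂ := by
  have : Mono (lift (𝟙 _) (vertex Δ[1] 1)) := mono_of_mono_fac (lift_fst _ _)
  have : Mono (lift (vertex Δ[1] 1) (𝟙 _)) := mono_of_mono_fac (lift_snd _ _)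
  let onSource := whiskerRight i t
  let onFst : PartialHom θ A (X ⊗ Δ[1] ⊗ Δ[1]) S := whiskerLeft (lift (𝟙 _) (vertex Δ[1] 1)) v₁
  let onSnd : PartialHom θ A (X ⊗ Δ[1] ⊗ Δ[1]) S := whiskerLeft (lift (vertex Δ[1] 1) (𝟙 _)) v₂
  have hB (m) (y : (X ⊗ Δ[1] ⊗ Δ[1] : SSet.{0}).obj m) :
      y ∈ (squareBoundary (SSet.Subcomplex.range i)).obj m ↔
        ∃ u ∈ ({onSource, onSnd, onFst} : Set _), y ∈ Set.range (u.f.app m) := by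
    simp only [onSource, onFst, onSnd, Set.mem_insert_iff, Set.mem_singleton_iff,
      exists_eq_or_imp, exists_eq_left, mem_range_whiskerRight_f, mem_range_whiskerLeft_f,
      mem_range_fstSide_iff, mem_range_sndSide_iff, mem_squareBoundary]
    rfl
  have hagree : ({onSource, onSnd, onFst} : Set (PartialHom θ A (X ⊗ Δ[1] ⊗ Δ[1]) S)).Pairwise
      Agree := by
    simp only [Set.pairwise_insert_of_symm, Set.mem_insert_iff, Set.mem_singleton_iff,
      forall_eq_or_imp, forall_eq, Set.pairwise_singleton, true_and]
    exact ⟨fun _ => symm (agree_sides h₁₂),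
      fun _ => agree_whiskerRight_whiskerLeft (fun _ => inf_le_right) h₂,
      fun _ => agree_whiskerRight_whiskerLeft (fun _ => inf_le_left) h₁⟩
  obtain ⟨w, hw⟩ := exists_mapping_extension {onSource, onSnd, onFst} hA
    (by
      rintro _ (rfl | rfl | rfl)
      exacts [mono_whiskerRight_f _ t, mono_whiskerLeft_f _ v₂, mono_whiskerLeft_f _ v₁])
    hagree
    (by
      rintro _ (rfl | rfl | rfl)
      exacts [valued_whiskerRight _ t,
        valued_whiskerLeft _ (fun l => le_inf (le_comap_interval_vertex_one _ l) le_rfl) v₂,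
        valued_whiskerLeft _ (fun l => le_inf le_rfl (le_comap_interval_vertex_one _ l)) v₁])
    _ hB (acyclic_square hPQ _)
  exact ⟨w, comp_eq_of_res_whiskerRight (hw onSource (.inl rfl)),
    comp_mappingMap_eq_of_res_whiskerLeft (fun _ => inf_le_left) (hw onFst (.inr (.inr rfl))),
    comp_mappingMap_eq_of_res_whiskerLeft (fun _ => inf_le_right) (hw onSnd (.inr (.inl rfl)))⟩

lemma hasLiftingProperty_squareToPullback (hA : A.IsCofibrant)
    (hPQ : P.toAddSubgroup ⊔ Q.toAddSubgroup = ⊤) {X' X : SSet.{0}} (i : X' ⟶ X) [Mono i] :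
    HasLiftingProperty i (squareToPullback (θ := θ) (A := A) P Q) := by
  refine ⟨fun {t v} sq => ?_⟩
  have h₁ : t ≫ squareFst P Q = i ≫ v ≫ pullback.fst _ _ := by
    rw [← Category.assoc, ← sq.w, Category.assoc, squareToPullback, pullback.lift_fst]
  have h₂ : t ≫ squareSnd P Q = i ≫ v ≫ pullback.snd _ _ := by
    rw [← Category.assoc, ← sq.w, Category.assoc, squareToPullback, pullback.lift_snd]
  have h₁₂ : (v ≫ pullback.fst _ _) ≫ evalOne P = (v ≫ pullback.snd _ _) ≫ evalOne Q := by
    rw [Category.assoc, Category.assoc, pullback.condition]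
  obtain ⟨w, hwi, hw₁, hw₂⟩ := exists_square_extension hA hPQ i h₁ h₂ h₁₂
  refine ⟨⟨⟨w, hwi, pullback.hom_ext ?_ ?_⟩⟩⟩
  · rw [Category.assoc, squareToPullback, pullback.lift_fst, hw₁]
  · rw [Category.assoc, squareToPullback, pullback.lift_snd, hw₂]

end CochainAction

/-! ### The arithmetic square of rings -/

section

open scoped TensorProduct

namespace ZHat

lemma exists_eq_natCast_add_prime_mul {ℓ : ℕ} (hℓ : ℓ.Prime) (z : ZHat) :
    ∃ (m : ℕ) (w : ZHat), z = m + ℓ * w := by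
  have : Fact ℓ.Prime := ⟨hℓ⟩
  let m : ℕ := PadicInt.zmodRepr (p := ℓ) (z ⟨ℓ, hℓ⟩)
  have h (p : Nat.Primes) : ∃ x : ℤ_[p], z p = m + ℓ * x := by
    by_cases hp : p = ⟨ℓ, hℓ⟩
    · subst hp
      obtain ⟨x, hx⟩ := Ideal.mem_span_singleton.1
        (PadicInt.maximalIdeal_eq_span_p (p := ℓ) ▸ PadicInt.sub_zmodRepr_mem (z ⟨ℓ, hℓ⟩))
      exact ⟨x, sub_eq_iff_eq_add'.1 hx⟩
    · have hcop : (p : ℕ).Coprime ℓ := (Nat.coprime_primes p.2 hℓ).2 fun h => hp (Subtype.ext h)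
      obtain ⟨u, hu⟩ := PadicInt.isUnit_iff.2 (PadicInt.norm_natCast_eq_one_iff.2 hcop)
      exact ⟨(↑u⁻¹ : ℤ_[p]) * (z p - m), by rw [← hu, Units.mul_inv_cancel_left]; ring⟩
  choose w hw using h
  exact ⟨m, w, funext hw⟩

lemma exists_eq_natCast_add_natCast_mul {b : ℕ} (hb : b ≠ 0) (z : ZHat) :
    ∃ (m : ℕ) (w : ZHat), z = m + b * w := by
  induction b using induction_on_primes generalizing z with
  | zero => exact (hb rfl).elim
  | one => exact ⟨0, z, by simp⟩
  | prime_mul ℓ b hℓ ih =>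
    obtain ⟨m, w, rfl⟩ := ih (right_ne_zero_of_mul hb) z
    obtain ⟨k, w', rfl⟩ := exists_eq_natCast_add_prime_mul hℓ w
    exact ⟨m + b * k, w', by push_cast; ring⟩

lemma intCast_injective : Function.Injective (Int.cast : ℤ → ZHat) := fun _ _ h =>
  Int.cast_injective (α := ℤ_[(⟨2, Nat.prime_two⟩ : Nat.Primes)])
    (congrFun h ⟨2, Nat.prime_two⟩)

lemma den_eq_one_of_den_mul_eq_num {q : ℚ} {z : ZHat} (h : q.den * z = q.num) : q.den = 1 := by
  by_contra hne
  obtain ⟨ℓ, hℓ, hdvd⟩ := Nat.exists_prime_and_dvd hne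
  have : Fact ℓ.Prime := ⟨hℓ⟩
  let x : ℤ_[ℓ] := z ⟨ℓ, hℓ⟩
  have hx : q.den * x = q.num := congrFun h ⟨ℓ, hℓ⟩
  have hnum : ‖(q.num : ℤ_[ℓ])‖ < 1 := calc
    ‖(q.num : ℤ_[ℓ])‖ = ‖(q.den : ℤ_[ℓ])‖ * ‖x‖ := by rw [← hx, norm_mul]
    _ ≤ ‖(q.den : ℤ_[ℓ])‖ := mul_le_of_le_one_right (norm_nonneg _) (PadicInt.norm_le_one x)
    _ < 1 := PadicInt.norm_natCast_lt_one_iff.2 hdvd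
  have hdvd' := Int.natCast_dvd.1 ((PadicInt.norm_int_lt_one_iff_dvd _).1 hnum)
  exact Nat.not_coprime_of_dvd_of_dvd hℓ.one_lt hdvd' hdvd q.reduced

end ZHat

lemma zHatToQHat_injective : Function.Injective zHatToQHat.hom :=
  Algebra.TensorProduct.includeLeft_injective (S := ℤ) (Int.cast_injective (α := ℚ))

lemma ratToQHat_injective : Function.Injective ratToQHat.hom :=
  Algebra.TensorProduct.includeRight_injective (R := ℤ) (A := ZHat) (B := ℚ)
    ZHat.intCast_injective

lemma zHatToQHat_mul_ratToQHat (z : ZHat) (q : ℚ) :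
    zHatToQHat.hom z * ratToQHat.hom q = (z ⊗ₜ[ℤ] q : QHat) :=
  (Algebra.TensorProduct.tmul_mul_tmul z 1 1 q).trans (by rw [mul_one, one_mul])

lemma exists_tmul_eq_zHatToQHat_add_ratToQHat (z : ZHat) (q : ℚ) :
    ∃ (w : ZHat) (r : ℚ), (z ⊗ₜ[ℤ] q : QHat) = zHatToQHat.hom w + ratToQHat.hom r := by
  obtain ⟨m, w, hw⟩ := ZHat.exists_eq_natCast_add_natCast_mul q.den_ne_zero (q.num * z)
  have hw' := congrArg zHatToQHat.hom hw
  simp only [map_mul, map_add, map_intCast, map_natCast] at hw'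
  have hden : (q.den : QHat) * ratToQHat.hom (1 / q.den) = 1 := by
    rw [← map_natCast ratToQHat.hom, ← map_mul, mul_one_div_cancel (by simp), map_one]
  have hq : ratToQHat.hom q = (q.num : QHat) * ratToQHat.hom (1 / q.den) := by
    rw [← map_intCast ratToQHat.hom, ← map_mul, mul_one_div, Rat.num_div_den]
  refine ⟨w, m * (1 / q.den), ?_⟩
  rw [← zHatToQHat_mul_ratToQHat, hq, map_mul, map_natCast]
  linear_combination (ratToQHat.hom (1 / q.den)) * hw' + zHatToQHat.hom w * hden

lemma range_zHatToQHat_sup_range_ratToQHat :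
    zHatToQHat.hom.range.toAddSubgroup ⊔ ratToQHat.hom.range.toAddSubgroup = ⊤ := by
  refine eq_top_iff.2 fun x _ => ?_
  change QHat at x
  induction x using TensorProduct.induction_on with
  | zero => exact zero_mem _
  | add x y hx hy => exact add_mem (hx trivial) (hy trivial)
  | tmul z q =>
    obtain ⟨w, r, h⟩ := exists_tmul_eq_zHatToQHat_add_ratToQHat z q
    rw [h]
    exact AddSubgroup.add_mem_sup ⟨w, rfl⟩ ⟨r, rfl⟩

lemma range_zHatToQHat_inf_range_ratToQHat_le :
    zHatToQHat.hom.range ⊓ ratToQHat.hom.range ≤ (zHatToQHat.hom.comp intToZHat.hom).range := by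
  rintro _ ⟨⟨z, rfl⟩, q, hq⟩
  have h : q.den * z = q.num := by
    apply zHatToQHat_injective
    rw [map_mul, map_natCast, map_intCast, ← hq, ← map_natCast ratToQHat.hom, ← map_mul,
      mul_comm, Rat.mul_den_eq_num, map_intCast]
  have hz : z = q.num := by
    rw [← h, ZHat.den_eq_one_of_den_mul_eq_num h, Nat.cast_one, one_mul]
  exact ⟨q.num, by rw [hz]; rfl⟩

end

/-! ### Contractions and the homotopy cartesian square -/

section

open MonoidalCategory CartesianMonoidalCategory

/-- The morphism `Δ[1] ⊗ Δ[1] ⟶ Δ[1]` given by the minimum on the vertices. -/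
def minMap : (Δ[1] ⊗ Δ[1] : SSet.{0}) ⟶ Δ[1] :=
  squareMap ⟨fun a => a.1 ⊓ a.2, fun _ _ h => inf_le_inf h.1 h.2⟩

variable {X : SSet.{0}} {n : SimplexCategoryᵒᵖ}

lemma minMap_app_vertex_zero (s : (Δ[1] : SSet.{0}).obj n) (x : X.obj n) :
    minMap.app n (s, (vertex X 0).app n x) = (vertex X 0).app n x := by
  induction n using Opposite.rec with | _ n
  induction n using SimplexCategory.rec with | _ n
  exact SSet.stdSimplex.ext _ _ fun i => min_eq_right (Fin.zero_le _)

lemma minMap_app_vertex_one (s : (Δ[1] : SSet.{0}).obj n) (x : X.obj n) :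
    minMap.app n (s, (vertex X 1).app n x) = s := by
  induction n using Opposite.rec with | _ n
  induction n using SimplexCategory.rec with | _ n
  exact SSet.stdSimplex.ext _ _ fun i => min_eq_left (Fin.le_last _)

lemma minMap_mem_endpoint_zero {s : (Δ[1] : SSet.{0}).obj n} (hs : s ∈ (endpoint 0).obj n)
    (t : (Δ[1] : SSet.{0}).obj n) : minMap.app n (s, t) ∈ (endpoint 0).obj n := by
  induction n using Opposite.rec with | _ n
  induction n using SimplexCategory.rec with | _ n
  exact mem_endpoint_iff.2 fun i =>
    Fin.le_zero_iff.1 ((min_le_left _ _).trans (mem_endpoint_iff.1 hs i).le)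

/-- The contraction of `Δ[1]` to the vertex `0`. -/
def intervalContraction : SSet.Homotopy (vertex Δ[1] 0) (𝟙 Δ[1]) :=
  homotopyOfCylinder minMap (by ext n s; exact minMap_app_vertex_zero s s)
    (by ext n s; exact minMap_app_vertex_one s s)

/-- The contraction of `Δ[1] ⊗ Δ[1]` to the vertex `(0, 0)`. -/
def squareContraction : SSet.Homotopy
    (SSet.const (Y := Δ[1] ⊗ Δ[1])
      (SSet.stdSimplex.obj₀Equiv.symm 0, SSet.stdSimplex.obj₀Equiv.symm 0))
    (𝟙 (Δ[1] ⊗ Δ[1] : SSet.{0})) :=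
  homotopyOfCylinder
    (lift (fst _ _ ▷ Δ[1] ≫ minMap) (snd _ _ ▷ Δ[1] ≫ minMap))
    (by
      refine CartesianMonoidalCategory.hom_ext _ _ ?_ ?_ <;> ext n s
      exacts [minMap_app_vertex_zero s.1 s, minMap_app_vertex_zero s.2 s])
    (by
      refine CartesianMonoidalCategory.hom_ext _ _ ?_ ?_ <;> ext n s
      exacts [minMap_app_vertex_one s.1 s, minMap_app_vertex_one s.2 s])

end

namespace CoeffSystem

variable {S : Type} [CommRing S] {R P Q : Subring S}

lemma const_le_interval : .const Δ[1] R ≤ interval R :=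
  fun _ _ hs => mem_val_interval.2 fun _ => hs

lemma comap_interval_vertex_zero_le :
    (interval R).comap (vertex Δ[1] 0) ≤ .const Δ[1] R :=
  fun s _ h => mem_val_interval.1 h (vertex_mem_endpoint 0 s)

lemma interval_minMap_le {n : SimplexCategoryᵒᵖ} (s t : (Δ[1] : SSet.{0}).obj n) :
    (interval R).val (minMap.app n (s, t)) ≤ (interval R).val s :=
  fun _ h => mem_val_interval.2 fun hs =>
    mem_val_interval.1 h (minMap_mem_endpoint_zero hs t)

end CoeffSystem

namespace CochainAction

open MonoidalCategory CartesianMonoidalCategory CoeffSystem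

variable {E : DGOperad} {θ : CochainAction E} {A : E.Alg} {R P Q S : Type} [CommRing R]
  [CommRing P] [CommRing Q] [CommRing S]

lemma isWeakEquivalence_toMapping_point :
    IsWeakEquivalence (toMapping (RingHom.id S) (fun _ => le_top) :
      (θ.T A).obj _ ⟶ θ.mapping A Δ[0] (.const Δ[0] ⊤)) :=
  isWeakEquivalence_toMapping Function.injective_id (SSet.stdSimplex.obj₀Equiv.symm 0)
    (fun _ _ _ => ⟨_, rfl⟩)
    (homotopyOfCylinder (fst _ _) (SSet.stdSimplex.isTerminalObj₀.hom_ext _ _) rfl)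
    (fun _ => le_rfl) _

lemma isWeakEquivalence_toMapping_interval {φ : R →+* S} (hφ : Function.Injective φ) :
    IsWeakEquivalence (toMapping φ const_le_interval :
      (θ.T A).obj _ ⟶ θ.mapping A Δ[1] (.interval φ.range)) :=
  isWeakEquivalence_toMapping hφ _ comap_interval_vertex_zero_le intervalContraction
    (fun y => interval_minMap_le y.1 y.2) _

lemma const_range_comp_le_square {f : R →+* P} {g : R →+* Q} {p : P →+* S} {q : Q →+* S}
    (w : p.comp f = q.comp g) :
    .const (Δ[1] ⊗ Δ[1]) (p.comp f).range ≤ square p.range q.range := by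
  rintro _ y _ ⟨r, rfl⟩
  exact mem_val_square.2 ⟨fun _ => ⟨f r, rfl⟩, fun _ => ⟨g r, (RingHom.congr_fun w r).symm⟩⟩

variable {f : R →+* P} {g : R →+* Q} {p : P →+* S} {q : Q →+* S} (w : p.comp f = q.comp g)

lemma isWeakEquivalence_toMapping_square (h : Function.Injective (p.comp f))
    (hinf : p.range ⊓ q.range ≤ (p.comp f).range) :
    IsWeakEquivalence (toMapping (p.comp f) (const_range_comp_le_square w) :
      (θ.T A).obj _ ⟶ θ.mapping A (Δ[1] ⊗ Δ[1]) (.square p.range q.range)) := by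
  refine isWeakEquivalence_toMapping h _ ?_ squareContraction
    (fun y => inf_le_inf (interval_minMap_le y.1.1 y.2) (interval_minMap_le y.1.2 y.2)) _
  exact fun y _ hy => hinf
    ⟨comap_interval_vertex_zero_le y.1 hy.1, comap_interval_vertex_zero_le y.2 hy.2⟩

lemma toMapping_evalOne (p : P →+* S) :
    toMapping p const_le_interval ≫ evalOne p.range =
      (θ.T A).map (CommRingCat.ofHom p) ≫ toMapping (RingHom.id S) (fun _ => le_top) := by
  ext n ψ
  exact mapping_ext fun q a m y => rfl

lemma toMapping_squareFst :
    toMapping (p.comp f) (const_range_comp_le_square w) ≫ squareFst p.range q.range =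
      (θ.T A).map (CommRingCat.ofHom f) ≫ toMapping p const_le_interval := by
  ext n ψ
  exact mapping_ext fun q a m y => rfl

lemma toMapping_squareSnd :
    toMapping (p.comp f) (const_range_comp_le_square w) ≫ squareSnd p.range q.range =
      (θ.T A).map (CommRingCat.ofHom g) ≫ toMapping q const_le_interval := by
  ext n ψ
  exact mapping_ext fun q a m y => RingHom.congr_fun w _

lemma toMapping_squareToPullback
    (h : ((θ.T A).map (CommRingCat.ofHom f) ≫ toMapping p const_le_interval) ≫ evalOne p.range =
      ((θ.T A).map (CommRingCat.ofHom g) ≫ toMapping q const_le_interval) ≫ evalOne q.range) :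
    toMapping (p.comp f) (const_range_comp_le_square w) ≫ squareToPullback p.range q.range =
      pullback.lift _ _ h := by
  refine pullback.hom_ext ?_ ?_
  · rw [Category.assoc, squareToPullback, pullback.lift_fst, pullback.lift_fst,
      toMapping_squareFst w]
  · rw [Category.assoc, squareToPullback, pullback.lift_snd, pullback.lift_snd,
      toMapping_squareSnd w]

end CochainAction

theorem mainTheorem4_general (E : DGOperad) (θ : CochainAction E) (A : E.Alg)
    (hA : A.IsCofibrant) {R P Q S : Type} [CommRing R] [CommRing P] [CommRing Q] [CommRing S]
    (f : R →+* P) (g : R →+* Q) (p : P →+* S) (q : Q →+* S) (w : p.comp f = q.comp g)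
    (hf : Function.Injective f) (hp : Function.Injective p) (hq : Function.Injective q)
    (hinf : p.range ⊓ q.range ≤ (p.comp f).range)
    (hsup : p.range.toAddSubgroup ⊔ q.range.toAddSubgroup = ⊤) :
    IsHomotopyCartesian ((θ.T A).map (CommRingCat.ofHom f)) ((θ.T A).map (CommRingCat.ofHom g))
      ((θ.T A).map (CommRingCat.ofHom p)) ((θ.T A).map (CommRingCat.ofHom q)) := by
  refine ⟨?_, _, _, _, CochainAction.toMapping p CoeffSystem.const_le_interval,
    CochainAction.toMapping q CoeffSystem.const_le_interval,
    CochainAction.toMapping (RingHom.id S) (fun _ => le_top),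
    CochainAction.evalOne p.range, CochainAction.evalOne q.range,
    CochainAction.toMapping_evalOne p, CochainAction.toMapping_evalOne q,
    CochainAction.isWeakEquivalence_toMapping_interval hp,
    CochainAction.isWeakEquivalence_toMapping_interval hq,
    CochainAction.isWeakEquivalence_toMapping_point, CochainAction.kanComplex_mapping hA ⊤,
    CochainAction.fibration_evalOne hA _, CochainAction.fibration_evalOne hA _, ?_⟩
  · rw [← Functor.map_comp, ← Functor.map_comp, ← CommRingCat.ofHom_comp, w,
      CommRingCat.ofHom_comp]
  · rw [← CochainAction.toMapping_squareToPullback w]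
    exact (CochainAction.isWeakEquivalence_toMapping_square w (hp.comp hf) hinf).comp
      (isWeakEquivalence_of_hasLiftingProperty _ fun i _ =>
        CochainAction.hasLiftingProperty_squareToPullback hA hsup i)

end

theorem mainTheorem4 (E : DGOperad) (hE : E.IsEInfinity) (hEc : E.IsCofibrant)
    (θ : CochainAction E) (A : E.Alg) (hA : A.IsCofibrant) :
    IsHomotopyCartesian ((θ.T A).map intToZHat) ((θ.T A).map intToRat)
      ((θ.T A).map zHatToQHat) ((θ.T A).map ratToQHat) :=
  mainTheorem4_general E θ A hA intToZHat.hom intToRat.hom zHatToQHat.hom ratToQHat.hom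
    (RingHom.ext_int _ _) ZHat.intCast_injective zHatToQHat_injective ratToQHat_injective
    range_zHatToQHat_inf_range_ratToQHat_le range_zHatToQHat_sup_range_ratToQHat
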